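/- Let $(X,d)$ be a complete separable metric space and let $E:X\to\mathbb R\cup\{+\infty\}$ be lower semicontinuous, bounded from below on every $d$-bounded set, with dense domain $D(E)=\{E<\infty\}$. Assume that for some $\lambda\in\mathbb R$ every $x\in X$ is the starting point of an $\mathrm{EVI}_\lambda$-gradient flow of $E$, that is, of a curve $(\gamma_t)_{t>0}$ in $AC_{loc}((0,\infty),X)$ with $\gamma_t\to x$ as $t\downarrow0$ such that, for every $y\in X$ and a.e. $t>0$, $$\tfrac12\tfrac{d}{dt}d^2(\gamma_t,y)+\tfrac\lambda2 d^2(\gamma_t,y)+E(\gamma_t)\le E(y).$$ Let $|\partial E|(x):=\limsup_{y\to x}[E(x)-E(y)]^+/d(x,y)$ for $x\in D(E)$ (equal to $0$ if $x$ is isolated), and $|\partial E|(x):=+\infty$ for $x\notin D(E)$. Assume that there is a Hausdorff topology $\sigma$ on $X$ such that every $d$-bounded sequence has a $\sigma$-convergent subsequence (with limit in $X$), and such that $d$ (jointly in its two arguments) and $|\partial E|$ are $\sigma$-sequentially lower semicontinuous. For a continuous curve $\gamma:[0,1]\to X$ and $\varepsilon>0$ let $$\mathcal A_\varepsilon(\gamma):=\frac12\int_0^1|\dot\gamma_t|^2\,dt+\frac{\varepsilon^2}{2}\int_0^1|\partial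 E|^2(\gamma_t)\,dt\in[0,+\infty],$$ where $|\dot\gamma_t|$ is the metric speed and the first term is $+\infty$ if $\gamma$ is not absolutely continuous. Then for all $x,y\in X$ and every $\varepsilon>0$ the following are equivalent: (a) the metric Schrödinger problem $\inf\{\mathcal A_\varepsilon(\gamma):\gamma\in C([0,1],X),\ \gamma_0=x,\ \gamma_1=y\}$ is solvable, i.e. its infimum is finite and attained; (b) $E(x)<\infty$, $E(y)<\infty$, and there is an absolutely continuous curve $\gamma:[0,1]\to X$ with $\gamma_0=x$ and $\gamma_1=y$. -/

import Mathlib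

open Set Filter Topology MeasureTheory
open scoped ENNReal

noncomputable section

namespace MetricSchrodinger

variable {X : Type*} [MetricSpace X]

/-- Absolute continuity of a curve on `[a, b]` with values in a metric space: the increments are
controlled by the integral of some `m ∈ L¹(a, b)`. Curves are functions on `ℝ`, of which only
the values on the relevant interval matter. -/
def ACOn (γ : ℝ → X) (a b : ℝ) : Prop :=
  ∃ m : ℝ → ℝ, IntegrableOn m (Icc a b) ∧
    ∀ s t : ℝ, a ≤ s → s ≤ t → t ≤ b → dist (γ s) (γ t) ≤ ∫ r in s..t, m r

/-- Local absolute continuity on `(0, ∞)`. -/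
def ACLoc (γ : ℝ → X) : Prop :=
  ∀ a b : ℝ, 0 < a → a < b → ACOn γ a b

/-- The metric speed `lim_{s → t} d(γ_s, γ_t) / |s - t|`. It is written with a `limsup`, which is the
limit whenever the limit exists, hence at almost every time along an absolutely continuous curve. -/
def metricSpeed (γ : ℝ → X) (t : ℝ) : ℝ≥0∞ :=
  limsup (fun s : ℝ => edist (γ s) (γ t) / edist s t) (𝓝[≠] t)

/-- The domain `D(E)`. -/
def domain (E : X → EReal) : Set X := {x | E x < ⊤}

open Classical in
/-- The slope `|∂E|`: it is `+∞` outside `D(E)`, and `limsup_{y → x} [E(x) - E(y)]⁺ / d(x, y)` at points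
of `D(E)` (with value `0` at isolated points, where the `limsup` is along the trivial filter).
`EReal.toENNReal` is the positive part. -/
def metricSlope (E : X → EReal) (x : X) : ℝ≥0∞ :=
  if x ∈ domain E then limsup (fun y : X => (E x - E y).toENNReal / edist x y) (𝓝[≠] x) else ⊤

/-- `γ` (on `t > 0`) is a gradient flow of `E` in the `EVI_lam` sense. Since `γ` is locally absolutely
continuous, the derivative of `t ↦ d²(γ_t, y)` exists at almost every time. -/
def IsEVIFlow (E : X → EReal) (lam : ℝ) (γ : ℝ → X) : Prop :=
  ACLoc γ ∧
    ∀ y : X, ∀ᵐ t ∂(volume.restrict (Ioi (0 : ℝ))), ∃ D : ℝ,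
      HasDerivAt (fun s : ℝ => dist (γ s) y ^ 2) D t ∧
        ((1 / 2 * D + lam / 2 * dist (γ t) y ^ 2 : ℝ) : EReal) + E (γ t) ≤ E y

/-- The curve `γ` (on `t > 0`) starts at `x`. -/
def StartsAt (E : X → EReal) (γ : ℝ → X) (x : X) : Prop :=
  x ∈ closure (domain E) ∧ Tendsto γ (𝓝[>] (0 : ℝ)) (𝓝 x)

/-- The standing assumptions on a functional `E : X → ℝ ∪ {+∞}` over the complete separable metric
space `X`. -/
structure Setting (E : X → EReal) : Prop where
  ne_bot : ∀ x, E x ≠ ⊥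
  lsc : LowerSemicontinuous E
  dense_domain : Dense (domain E)
  bounded_below : ∀ B : Set X, Bornology.IsBounded B → ∃ c : ℝ, ∀ x ∈ B, (c : EReal) ≤ E x
  flow : ∃ lam : ℝ, ∀ x : X, ∃ γ : ℝ → X, IsEVIFlow E lam γ ∧ StartsAt E γ x

/-- There is a Hausdorff topology `σ` on `X` for which `d`-bounded sequences have convergent
subsequences, and `d` and `|∂E|` are sequentially lower semicontinuous. -/
def WeakTopologyAssumption (E : X → EReal) : Prop :=
  ∃ σ : TopologicalSpace X,
    @T2Space X σ ∧
    (∀ u : ℕ → X, Bornology.IsBounded (range u) →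
      ∃ (z : X) (φ : ℕ → ℕ), StrictMono φ ∧ Tendsto (u ∘ φ) atTop (@nhds X σ z)) ∧
    (∀ (u v : ℕ → X) (x y : X), Tendsto u atTop (@nhds X σ x) → Tendsto v atTop (@nhds X σ y) →
      edist x y ≤ liminf (fun n => edist (u n) (v n)) atTop) ∧
    (∀ (u : ℕ → X) (x : X), Tendsto u atTop (@nhds X σ x) →
      metricSlope E x ≤ liminf (fun n => metricSlope E (u n)) atTop)

open Classical in
/-- The kinetic energy `½ ∫₀¹ |γ̇_t|² dt`, equal to `+∞` if `γ` is not absolutely continuous. -/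
def kineticEnergy (γ : ℝ → X) : ℝ≥0∞ :=
  if ACOn γ 0 1 then 2⁻¹ * ∫⁻ t in Icc (0 : ℝ) 1, metricSpeed γ t ^ 2 else ⊤

/-- The halved Fisher information `½ ∫₀¹ |∂E|²(γ_t) dt`. -/
def fisherInformation (E : X → EReal) (γ : ℝ → X) : ℝ≥0∞ :=
  2⁻¹ * ∫⁻ t in Icc (0 : ℝ) 1, metricSlope E (γ t) ^ 2

/-- The action minimized in the Schrödinger problem at temperature `ε`. -/
def schrodingerAction (E : X → EReal) (ε : ℝ) (γ : ℝ → X) : ℝ≥0∞ :=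
  kineticEnergy γ + ENNReal.ofReal (ε ^ 2) * fisherInformation E γ

/-- Continuous curves on `[0, 1]` from `x` to `y`. -/
def curvesJoining (x y : X) : Set (ℝ → X) :=
  {γ | ContinuousOn γ (Icc (0 : ℝ) 1) ∧ γ 0 = x ∧ γ 1 = y}

/-- The Schrödinger problem between `x` and `y` is solvable: some competitor attains the infimum,
and the infimum is finite. -/
def SchrodingerSolvable (E : X → EReal) (ε : ℝ) (x y : X) : Prop :=
  ∃ γ ∈ curvesJoining x y, schrodingerAction E ε γ < ⊤ ∧
    IsMinOn (schrodingerAction E ε) (curvesJoining x y) γ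

end MetricSchrodinger

end

/-!
An `EVI` flow is a `κ`-contraction up to exponential factors, dissipates the energy, and its slope
at time `t > 0` is finite. Hence running the flow from a point of finite energy costs finite
action, and pushing an absolutely continuous curve forward by the flow at a fixed positive time
yields, after reparametrization, a Lipschitz curve of bounded slope. Concatenation turns every
absolutely continuous curve with endpoints of finite energy into a competitor of finite action,
and the direct method in the weak topology then produces a minimizer. Conversely, along a curve of
finite action the bound `E x ≤ E y + |∂E|(x) d(x, y) + κ/2 d²(x, y)`, applied at well chosen times
on a dyadic scale, keeps the energy bounded near the endpoints, where lower semicontinuity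
concludes.
-/

noncomputable section

namespace MetricSchrodinger

open scoped NNReal

/-! ### Real analysis -/

section RealAnalysis

variable {f : ℝ → ℝ} {a b : ℝ}

lemma sq_lintegral_le_measure_univ_mul {α : Type*} [MeasurableSpace α] (μ : Measure α)
    (f : α → ℝ≥0∞) : (∫⁻ t, f t ∂μ) ^ 2 ≤ μ univ * ∫⁻ t, f t ^ 2 ∂μ := by
  obtain ⟨g, hg, hgf, hint⟩ := exists_measurable_le_lintegral_eq μ f
  have hHolder := ENNReal.lintegral_mul_le_Lp_mul_Lq μ Real.HolderConjugate.two_two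
    (aemeasurable_const (b := (1 : ℝ≥0∞))) hg.aemeasurable
  simp only [Pi.mul_apply, one_mul, ENNReal.one_rpow, lintegral_one] at hHolder
  calc (∫⁻ t, f t ∂μ) ^ 2
      ≤ (μ univ ^ (1 / (2 : ℝ)) * (∫⁻ t, g t ^ (2 : ℝ) ∂μ) ^ (1 / (2 : ℝ))) ^ 2 := by
        rw [hint]; gcongr
    _ = μ univ * ∫⁻ t, g t ^ 2 ∂μ := by
        rw [mul_pow, ← ENNReal.rpow_natCast, ← ENNReal.rpow_natCast, ← ENNReal.rpow_mul,
          ← ENNReal.rpow_mul]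
        norm_num
    _ ≤ μ univ * ∫⁻ t, f t ^ 2 ∂μ := by
        gcongr with t
        exact hgf t

lemma exists_pos_forall_mem_Ioc {p : ℝ → Prop} (h : ∀ᶠ t in 𝓝[>] (0 : ℝ), p t) :
    ∃ T > 0, ∀ t ∈ Ioc 0 T, p t := by
  obtain ⟨T, hT, h⟩ := mem_nhdsGT_iff_exists_Ioc_subset.1 h
  exact ⟨T, hT, fun t ht => h ht⟩

lemma eventually_mul_lt_nhdsGT_zero (c : ℝ) {δ : ℝ} (hδ : 0 < δ) :
    ∀ᶠ t in 𝓝[>] (0 : ℝ), c * t < δ := by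
  have : Tendsto (fun t => c * t) (𝓝[>] 0) (𝓝 (c * 0)) :=
    (continuous_const_mul c).continuousWithinAt
  exact this.eventually_lt_const (by rwa [mul_zero])

lemma continuousOn_primitive_Icc (hab : a ≤ b) (hf : IntervalIntegrable f volume a b) :
    ContinuousOn (fun t => ∫ r in a..t, f r) (Icc a b) := by
  simpa only [uIcc_of_le hab] using
    intervalIntegral.continuousOn_primitive_interval' hf left_mem_uIcc

lemma tendsto_comp_sub_nhdsGT_zero {x : ℝ} (hf : ContinuousOn f (Icc a b)) (hx : x ∈ Ioc a b) :
    Tendsto (fun h => f (x - h)) (𝓝[>] 0) (𝓝 (f x)) := by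
  refine (hf x (Ioc_subset_Icc_self hx)).tendsto.comp (tendsto_nhdsWithin_iff.2 ⟨?_, ?_⟩)
  · have : Tendsto (fun h => x - h) (𝓝[>] 0) (𝓝 (x - 0)) :=
      (continuous_sub_left x).continuousWithinAt
    rwa [sub_zero] at this
  · filter_upwards [Ioc_mem_nhdsGT (sub_pos.2 hx.1)] with h hh
    exact ⟨by linarith [hh.2], by linarith [hx.2, hh.1]⟩

lemma hasDerivWithinAt_primitive_Ici (hf : ContinuousOn f (Icc a b)) {t : ℝ} (ht : t ∈ Ico a b) :
    HasDerivWithinAt (fun t => ∫ r in a..t, f r) (f t) (Ici t) t := by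
  have hmeas : StronglyMeasurableAtFilter f (𝓝[>] t) :=
    ⟨Ioc t b, Ioc_mem_nhdsGT ht.2, (hf.mono fun s hs => ⟨ht.1.trans hs.1.le, hs.2⟩)
      |>.aestronglyMeasurable measurableSet_Ioc⟩
  have hcont : ContinuousWithinAt f (Ioi t) t :=
    (hf t (Ico_subset_Icc_self ht)).mono_of_mem_nhdsWithin
      (mem_of_superset (Ioc_mem_nhdsGT ht.2) fun s hs => ⟨ht.1.trans hs.1.le, hs.2⟩)
  exact intervalIntegral.integral_hasDerivWithinAt_right
    ((hf.mono (Icc_subset_Icc_right ht.2.le)).intervalIntegrable_of_Icc ht.1) hmeas hcont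

/-- Grönwall's inequality in integral form. -/
lemma le_exp_mul_of_le_add_integral {k : ℝ} (hab : a ≤ b) (hk : 0 ≤ k)
    (hf : ContinuousOn f (Icc a b)) (h : ∀ t ∈ Icc a b, f t ≤ f a + k * ∫ r in a..t, f r) :
    f b ≤ Real.exp (k * (b - a)) * f a := by
  have hle := le_gronwallBound_of_liminf_deriv_right_le (f := fun t => f a + k * ∫ r in a..t, f r)
    (f' := fun t => k * f t) (δ := f a) (K := k) (ε := 0)
    (continuousOn_const.add
      (continuousOn_const.mul (continuousOn_primitive_Icc hab (hf.intervalIntegrable_of_Icc hab))))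
    (fun t ht r hr => (((hasDerivWithinAt_primitive_Ici hf ht).const_mul k).const_add
      (f a)).liminf_right_slope_le hr)
    (by simp)
    (fun t ht => by simpa using mul_le_mul_of_nonneg_left (h t (Ico_subset_Icc_self ht)) hk)
    b (right_mem_Icc.2 hab)
  rw [gronwallBound_ε0] at hle
  exact (h b (right_mem_Icc.2 hab)).trans (hle.trans_eq (mul_comm _ _))

lemma sqrt_add_integral_le {δ p : ℝ} (hb : 0 ≤ b) (hf : ContinuousOn f (Icc 0 b))
    (hpos : ∀ t ∈ Icc 0 b, 0 < δ + ∫ r in (0 : ℝ)..t, f r)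
    (h : ∀ t ∈ Icc 0 b, f t ≤ 2 * p * √(δ + ∫ r in (0 : ℝ)..t, f r)) :
    √(δ + ∫ r in (0 : ℝ)..b, f r) ≤ √δ + p * b := by
  refine image_le_of_deriv_right_le_deriv_boundary
    (f := fun t => √(δ + ∫ r in (0 : ℝ)..t, f r)) (B := fun t => √δ + p * t)
    (B' := fun _ => p) (a := 0) (b := b) ?_ (fun t ht =>
      ((hasDerivWithinAt_primitive_Ici hf ht).const_add δ).sqrt
        (hpos t (Ico_subset_Icc_self ht)).ne') (by simp) (by fun_prop) (fun t _ => ?_)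
    (fun t ht => ?_) ⟨hb, le_rfl⟩
  · exact (continuousOn_const.add
      (continuousOn_primitive_Icc hb (hf.intervalIntegrable_of_Icc hb))).sqrt
  · simpa using (((hasDerivAt_id t).const_mul p).const_add √δ).hasDerivWithinAt
  · have ht' := Ico_subset_Icc_self ht
    rw [div_le_iff₀ (mul_pos two_pos (Real.sqrt_pos.2 (hpos t ht')))]
    exact (h t ht').trans_eq (by ring)

/-- Bihari's inequality for the square root: `G = δ + ∫ f` satisfies `(√G)' ≤ √(q / 2)`. -/
lemma le_mul_of_sq_le_integral {q : ℝ} (hb : 0 ≤ b) (hq : 0 ≤ q)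
    (hf : ContinuousOn f (Icc 0 b)) (hf0 : ∀ t ∈ Icc 0 b, 0 ≤ f t)
    (h : ∀ t ∈ Icc 0 b, f t ^ 2 ≤ 2 * q * ∫ r in (0 : ℝ)..t, f r) : f b ≤ q * b := by
  have hprim : ∀ t ∈ Icc 0 b, 0 ≤ ∫ r in (0 : ℝ)..t, f r := fun t ht =>
    intervalIntegral.integral_nonneg ht.1 fun r hr => hf0 r ⟨hr.1, hr.2.trans ht.2⟩
  have hle_sqrt : ∀ δ > 0, ∀ t ∈ Icc 0 b, f t ≤ √(2 * q) * √(δ + ∫ r in (0 : ℝ)..t, f r) := by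
    intro δ hδ t ht
    rw [← Real.sqrt_mul (by positivity)]
    exact Real.le_sqrt_of_sq_le ((h t ht).trans (by gcongr; linarith))
  have hbound : ∀ δ > 0, f b ≤ √(2 * q) * √δ + q * b := by
    intro δ hδ
    have hG := sqrt_add_integral_le (p := √(2 * q) / 2) hb hf
      (fun t ht => by linarith [hprim t ht]) fun t ht => by
        simpa only [mul_div_cancel₀ _ (two_ne_zero' ℝ)] using hle_sqrt δ hδ t ht
    calc f b ≤ √(2 * q) * √(δ + ∫ r in (0 : ℝ)..b, f r) := hle_sqrt δ hδ b ⟨hb, le_rfl⟩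
      _ ≤ √(2 * q) * (√δ + √(2 * q) / 2 * b) := by gcongr
      _ = √(2 * q) * √δ + √(2 * q) ^ 2 / 2 * b := by ring
      _ = √(2 * q) * √δ + q * b := by rw [Real.sq_sqrt (by positivity)]; ring
  have hlim : Tendsto (fun δ => √(2 * q) * √δ + q * b) (𝓝[>] 0)
      (𝓝 (√(2 * q) * √0 + q * b)) :=
    (by fun_prop : Continuous fun δ => √(2 * q) * √δ + q * b).continuousWithinAt
  rw [Real.sqrt_zero, mul_zero, zero_add] at hlim
  exact ge_of_tendsto hlim (eventually_mem_nhdsWithin.mono fun δ hδ => hbound δ hδ)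

lemma tendsto_inv_mul_integral_sub_shift {H : ℝ → ℝ} {c : ℝ} (hca : c < a) (hab : a ≤ b)
    (hH : ContinuousOn H (Icc c b)) :
    Tendsto (fun h => h⁻¹ * ∫ t in a..b, (H t - H (t - h))) (𝓝[>] 0) (𝓝 (H b - H a)) := by
  obtain ⟨K, hK, hKH⟩ : ∃ K : ℝ → ℝ, Continuous K ∧ EqOn K H (Icc c b) :=
    ⟨IccExtend (hca.le.trans hab) (domRestrict (Icc c b) H),
      (continuousOn_iff_continuous_domRestrict.1 hH).Icc_extend', fun t ht => by
        rw [IccExtend_of_mem _ _ ht, domRestrict_apply]⟩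
  set R : ℝ → ℝ := fun x => ∫ t in (0 : ℝ)..x, K t with hR
  have hquot : ∀ x, Tendsto (fun h => h⁻¹ * (R x - R (x - h))) (𝓝[>] 0) (𝓝 (K x)) := fun x => by
    have hneg : Tendsto (fun h : ℝ => -h) (𝓝[>] 0) (𝓝[<] 0) := by
      simpa using tendsto_neg_nhdsGT (a := (0 : ℝ))
    refine ((hK.integral_hasStrictDerivAt 0 x).hasDerivAt.tendsto_slope_zero_left.comp
      hneg).congr fun h => ?_
    simp only [Function.comp, smul_eq_mul, inv_neg, ← sub_eq_add_neg, hR]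
    ring
  have hlim := (hquot b).sub (hquot a)
  rw [hKH ⟨hca.le.trans hab, le_rfl⟩, hKH ⟨hca.le, hab⟩] at hlim
  refine hlim.congr' ?_
  filter_upwards [Ioc_mem_nhdsGT (sub_pos.2 hca)] with h hh
  have hHK : ∫ t in a..b, (H t - H (t - h)) = ∫ t in a..b, (K t - K (t - h)) := by
    refine intervalIntegral.integral_congr fun t ht => ?_
    rw [uIcc_of_le hab] at ht
    simp only [hKH ⟨hca.le.trans ht.1, ht.2⟩,
      hKH (x := t - h) ⟨by linarith [ht.1, hh.2], by linarith [ht.2, hh.1]⟩]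
  have hprim : ∀ x y, ∫ t in x..y, K t = R y - R x := fun x y =>
    (intervalIntegral.integral_interval_sub_left (hK.intervalIntegrable 0 y)
      (hK.intervalIntegrable 0 x)).symm
  have hKs : Continuous fun t => K (t - h) := hK.comp (continuous_sub_right h)
  rw [hHK, intervalIntegral.integral_sub (hK.intervalIntegrable a b) (hKs.intervalIntegrable a b),
    intervalIntegral.integral_comp_sub_right, hprim, hprim]
  ring

/-- The increments of `H` are only controlled off a null set that depends on the step `h`, so the
bound is averaged over `t` before letting `h → 0`. -/
lemma sub_le_integral_add_integral_of_increment_le {H Φ Ψ : ℝ → ℝ} {c : ℝ} (hca : c < a)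
    (hab : a ≤ b) (hH : ContinuousOn H (Icc c b)) (hΦ : IntervalIntegrable Φ volume c b)
    (hΨ : IntervalIntegrable Ψ volume a b)
    (hinc : ∀ᶠ h in 𝓝[>] (0 : ℝ), ∀ᵐ t, t ∈ Icc a b →
      H t - H (t - h) ≤ h * (Φ (t - h) + Ψ t)) :
    H b - H a ≤ (∫ t in a..b, Φ t) + ∫ t in a..b, Ψ t := by
  have hcb := hca.le.trans hab
  have hΦ' : ∀ {s t}, s ∈ Icc c b → t ∈ Icc c b → IntervalIntegrable Φ volume s t := fun hs ht =>
    hΦ.mono_set (by rw [uIcc_of_le hcb]; exact uIcc_subset_Icc hs ht)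
  set P : ℝ → ℝ := fun t => ∫ r in c..t, Φ r
  have hP : ContinuousOn P (Icc c b) := continuousOn_primitive_Icc hcb hΦ
  have hdiff : ∀ {s t}, s ∈ Icc c b → t ∈ Icc c b → ∫ r in s..t, Φ r = P t - P s := fun hs ht =>
    (intervalIntegral.integral_interval_sub_left (hΦ' (left_mem_Icc.2 hcb) ht)
      (hΦ' (left_mem_Icc.2 hcb) hs)).symm
  have ha : a ∈ Ioc c b := ⟨hca, hab⟩
  have hb : b ∈ Ioc c b := ⟨hca.trans_le hab, le_rfl⟩
  rw [hdiff (Ioc_subset_Icc_self ha) (Ioc_subset_Icc_self hb)]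
  refine le_of_tendsto_of_tendsto (tendsto_inv_mul_integral_sub_shift hca hab hH)
    (((tendsto_comp_sub_nhdsGT_zero hP hb).sub (tendsto_comp_sub_nhdsGT_zero hP ha)).add_const _) ?_
  filter_upwards [hinc, Ioc_mem_nhdsGT (sub_pos.2 hca)] with h hinc hh
  have ha' : a - h ∈ Icc c b := ⟨by linarith [hh.2], by linarith [hh.1]⟩
  have hb' : b - h ∈ Icc c b := ⟨by linarith [hh.2], by linarith [hh.1]⟩
  have hHa : IntervalIntegrable H volume a b :=
    (hH.mono (Icc_subset_Icc_left hca.le)).intervalIntegrable_of_Icc hab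
  have hHs : IntervalIntegrable (fun t => H (t - h)) volume a b := by
    refine (hH.comp (by fun_prop) fun t ht => ?_).intervalIntegrable_of_Icc hab
    exact ⟨by linarith [ht.1, hh.2], by linarith [ht.2, hh.1]⟩
  have hΦs : IntervalIntegrable (fun t => Φ (t - h)) volume a b := by
    simpa using (hΦ' ha' hb').comp_sub_right h
  have hmono := intervalIntegral.integral_mono_ae_restrict hab (hHa.sub hHs)
    ((hΦs.add hΨ).const_mul h) (by
      rwa [EventuallyLE, ae_restrict_iff' measurableSet_Icc])
  rwa [intervalIntegral.integral_const_mul, intervalIntegral.integral_add hΦs hΨ,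
    intervalIntegral.integral_comp_sub_right, hdiff ha' hb',
    ← inv_mul_le_iff₀ hh.1] at hmono

end RealAnalysis

section AbsolutelyContinuousCurves

variable {X : Type*} [MetricSpace X] {γ : ℝ → X} {a b : ℝ}

/-- `m ∈ L¹(a, b)` controls the increments of `γ` on `[a, b]`, as in the definition of `ACOn`. -/
def IsSpeedBound (γ : ℝ → X) (m : ℝ → ℝ) (a b : ℝ) : Prop :=
  IntegrableOn m (Icc a b) ∧
    ∀ s t : ℝ, a ≤ s → s ≤ t → t ≤ b → dist (γ s) (γ t) ≤ ∫ r in s..t, m r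

lemma absolutelyContinuousOnInterval_dist_const (hγ : AbsolutelyContinuousOnInterval γ a b)
    (z : X) : AbsolutelyContinuousOnInterval (fun t => dist (γ t) z) a b := by
  refine squeeze_zero (fun _ => Finset.sum_nonneg fun _ _ => dist_nonneg) (fun I => ?_) hγ
  exact Finset.sum_le_sum fun i _ => abs_dist_sub_le _ _ _

namespace IsSpeedBound

variable {m : ℝ → ℝ}

lemma intervalIntegrable (hm : IsSpeedBound γ m a b) (hab : a ≤ b) :
    IntervalIntegrable m volume a b :=
  (intervalIntegrable_iff_integrableOn_Icc_of_le hab).2 hm.1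

lemma mono (hm : IsSpeedBound γ m a b) {c d : ℝ} (hac : a ≤ c) (hdb : d ≤ b) :
    IsSpeedBound γ m c d :=
  ⟨hm.1.mono_set (Icc_subset_Icc hac hdb), fun s t hs hst ht =>
    hm.2 s t (hac.trans hs) hst (ht.trans hdb)⟩

lemma dist_le_abs_integral (hm : IsSpeedBound γ m a b) {s t : ℝ} (hs : s ∈ Icc a b)
    (ht : t ∈ Icc a b) : dist (γ s) (γ t) ≤ |(∫ r in a..t, m r) - ∫ r in a..s, m r| := by
  rw [intervalIntegral.integral_interval_sub_left ((hm.mono le_rfl ht.2).intervalIntegrable ht.1)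
    ((hm.mono le_rfl hs.2).intervalIntegrable hs.1)]
  rcases le_total s t with h | h
  · exact (hm.2 s t hs.1 h ht.2).trans (le_abs_self _)
  · rw [dist_comm, intervalIntegral.integral_symm, abs_neg]
    exact (hm.2 t s ht.1 h hs.2).trans (le_abs_self _)

lemma absolutelyContinuousOnInterval (hab : a ≤ b) (hm : IsSpeedBound γ m a b) :
    AbsolutelyContinuousOnInterval γ a b := by
  have hM := (hm.intervalIntegrable hab).absolutelyContinuousOnInterval_intervalIntegral (c := a)
    left_mem_uIcc
  refine squeeze_zero' (.of_forall fun _ => Finset.sum_nonneg fun _ _ => dist_nonneg) ?_ hM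
  have hmem : ∀ᶠ I in AbsolutelyContinuousOnInterval.totalLengthFilter ⊓
      𝓟 (AbsolutelyContinuousOnInterval.disjWithin a b),
      I ∈ AbsolutelyContinuousOnInterval.disjWithin a b :=
    eventually_inf_principal.2 (.of_forall fun _ h => h)
  filter_upwards [hmem] with I hI
  refine Finset.sum_le_sum fun i hi => ?_
  obtain ⟨hl, hr⟩ := hI.1 i hi
  rw [uIcc_of_le hab] at hl hr
  rw [Real.dist_eq, abs_sub_comm]
  exact hm.dist_le_abs_integral hl hr

lemma metricSpeed_le (hab : a ≤ b) (hm : IsSpeedBound γ m a b) :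
    ∀ᵐ t, t ∈ Ioo a b → metricSpeed γ t ≤ ENNReal.ofReal |m t| := by
  filter_upwards [(hm.intervalIntegrable hab).ae_hasDerivAt_integral] with t ht hmem
  rw [uIcc_of_le hab] at ht
  have hder := ht (Ioo_subset_Icc_self hmem) a (left_mem_Icc.2 hab)
  rw [← (ENNReal.tendsto_ofReal (hasDerivAt_iff_tendsto_slope.1 hder).abs).limsup_eq]
  refine limsup_le_limsup ?_
  filter_upwards [self_mem_nhdsWithin,
    mem_nhdsWithin_of_mem_nhds (Ioo_mem_nhds hmem.1 hmem.2)] with s hne hs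
  have hst : 0 < |s - t| := abs_pos.2 (sub_ne_zero.2 hne)
  rw [edist_dist, edist_dist, Real.dist_eq, ← ENNReal.ofReal_div_of_pos hst, slope_def_field,
    abs_div, abs_sub_comm (intervalIntegral m a s volume)]
  gcongr
  exact hm.dist_le_abs_integral (Ioo_subset_Icc_self hs) (Ioo_subset_Icc_self hmem)

end IsSpeedBound

lemma ACOn.absolutelyContinuousOnInterval (hab : a ≤ b) (h : ACOn γ a b) :
    AbsolutelyContinuousOnInterval γ a b :=
  let ⟨_, hm⟩ := h
  IsSpeedBound.absolutelyContinuousOnInterval hab hm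

lemma ACOn.continuousOn (hab : a ≤ b) (h : ACOn γ a b) : ContinuousOn γ (Icc a b) := by
  intro t ht
  have hc := (absolutelyContinuousOnInterval_dist_const
    (h.absolutelyContinuousOnInterval hab) (γ t)).continuousOn
  rw [uIcc_of_le hab] at hc
  have hlim := hc t ht
  rw [ContinuousWithinAt, dist_self] at hlim
  exact tendsto_iff_dist_tendsto_zero.2 hlim

lemma ACOn.mono (h : ACOn γ a b) {c d : ℝ} (hac : a ≤ c) (hdb : d ≤ b) : ACOn γ c d :=
  let ⟨m, hm⟩ := h
  ⟨m, IsSpeedBound.mono hm hac hdb⟩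

/-- The upper right speed of `γ` at time `t` is at most `C`, in a form where the bound is attained
by the difference quotients themselves. -/
def RightSpeedLE (γ : ℝ → X) (t C : ℝ) : Prop :=
  ∀ᶠ s in 𝓝[>] t, dist (γ s) (γ t) ≤ C * (s - t)

lemma rightSpeedLE_iff_nhdsGT_zero {t C : ℝ} :
    RightSpeedLE γ t C ↔ ∀ᶠ h in 𝓝[>] (0 : ℝ), dist (γ (h + t)) (γ t) ≤ C * h := by
  rw [RightSpeedLE, ← zero_add t, ← map_add_right_nhdsGT, eventually_map]
  simp

lemma rightSpeedLE_of_metricSpeed_lt {t C : ℝ} (h : metricSpeed γ t < ENNReal.ofReal C) :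
    RightSpeedLE γ t C := by
  have hC : 0 < C := ENNReal.ofReal_pos.1 (bot_le.trans_lt h)
  filter_upwards [nhdsGT_le_nhdsNE t (eventually_lt_of_limsup_lt h), self_mem_nhdsWithin]
    with s hs hst
  have hst : 0 < s - t := sub_pos.2 hst
  rw [edist_dist, edist_dist, Real.dist_eq, abs_of_pos hst, ← ENNReal.ofReal_div_of_pos hst,
    ENNReal.ofReal_lt_ofReal_iff hC, div_lt_iff₀ hst] at hs
  exact hs.le

lemma enorm_deriv_dist_le {z : X} {t : ℝ} {g : ℝ≥0∞}
    (hφ : DifferentiableAt ℝ (fun s => dist (γ s) z) t)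
    (hg : ∀ C : ℝ, g < ENNReal.ofReal C → RightSpeedLE γ t C) :
    ‖deriv (fun s => dist (γ s) z) t‖ₑ ≤ g := by
  rw [Real.enorm_eq_ofReal_abs]
  by_contra! hlt
  obtain ⟨C, hC0, hgC, hC⟩ := ENNReal.lt_iff_exists_real_btwn.1 hlt
  rw [ENNReal.ofReal_lt_ofReal_iff_of_nonneg hC0] at hC
  have hev := ((hasDerivAt_iff_tendsto_slope.1 hφ.hasDerivAt).abs.mono_left
    (nhdsGT_le_nhdsNE t)).eventually (lt_mem_nhds hC)
  obtain ⟨s, hs, hsC, hst⟩ := ((hg C hgC).and (hev.and self_mem_nhdsWithin)).exists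
  rw [slope_def_field, abs_div, abs_of_pos (sub_pos.2 hst), lt_div_iff₀ (sub_pos.2 hst)] at hsC
  exact absurd ((abs_dist_sub_le (γ s) (γ t) z).trans hs) (not_le.2 hsC)

lemma edist_le_lintegral_of_rightSpeedLE (hab : a ≤ b)
    (hγ : AbsolutelyContinuousOnInterval γ a b) {g : ℝ → ℝ≥0∞}
    (hg : ∀ᵐ t, t ∈ Ioo a b → ∀ C : ℝ, g t < ENNReal.ofReal C → RightSpeedLE γ t C) :
    edist (γ a) (γ b) ≤ ∫⁻ t in Ioc a b, g t := by
  set φ : ℝ → ℝ := fun t => dist (γ t) (γ a) with hφdef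
  have hφ : AbsolutelyContinuousOnInterval φ a b := absolutelyContinuousOnInterval_dist_const hγ _
  have hle : ∀ᵐ t ∂volume.restrict (Ioc a b), ‖deriv φ t‖ₑ ≤ g t := by
    rw [← restrict_Ioo_eq_restrict_Ioc, ae_restrict_iff' measurableSet_Ioo]
    filter_upwards [hg, hφ.ae_differentiableAt] with t hgt hdt ht
    exact enorm_deriv_dist_le (hdt (by rw [uIcc_of_le hab]; exact Ioo_subset_Icc_self ht)) (hgt ht)
  have hftc := hφ.integral_deriv_eq_sub
  rw [intervalIntegral.integral_of_le hab] at hftc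
  calc edist (γ a) (γ b) = ‖∫ t in Ioc a b, deriv φ t‖ₑ := by
        rw [hftc]
        simp [hφdef, edist_dist, Real.enorm_eq_ofReal_abs, dist_comm]
    _ ≤ ∫⁻ t in Ioc a b, ‖deriv φ t‖ₑ := enorm_integral_le_lintegral_enorm _
    _ ≤ ∫⁻ t in Ioc a b, g t := lintegral_mono_ae hle

lemma sq_setLIntegral_Ioc_le (g : ℝ → ℝ≥0∞) (a b : ℝ) :
    (∫⁻ t in Ioc a b, g t) ^ 2 ≤ ENNReal.ofReal (b - a) * ∫⁻ t in Ioc a b, g t ^ 2 := by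
  simpa using sq_lintegral_le_measure_univ_mul (volume.restrict (Ioc a b)) g

lemma ACOn.edist_sq_le {s t : ℝ} (h : ACOn γ a b) (has : a ≤ s) (hst : s ≤ t) (htb : t ≤ b) :
    edist (γ s) (γ t) ^ 2 ≤ ENNReal.ofReal (t - s) * ∫⁻ r in Ioc s t, metricSpeed γ r ^ 2 := by
  refine le_trans ?_ (sq_setLIntegral_Ioc_le _ s t)
  gcongr
  exact edist_le_lintegral_of_rightSpeedLE hst
    ((h.mono has htb).absolutelyContinuousOnInterval hst)
    (.of_forall fun _ _ _ hC => rightSpeedLE_of_metricSpeed_lt hC)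

end AbsolutelyContinuousCurves

/-! ### Integrated gradient flows -/

section IntegralFlow

variable {X : Type*} [MetricSpace X] {E : X → EReal} {κ : ℝ} {u w γ : ℝ → X} {a b : ℝ}

/-- The integrated form of the evolution variational inequality, for a curve that is continuous up
to time `0`. Its parameter is `-κ` with `κ ≥ 0`, so that `κ` is the rate of expansion of the
flow. -/
structure IsIntegralFlow (E : X → EReal) (κ : ℝ) (u : ℝ → X) : Prop where
  nonneg : 0 ≤ κ
  continuousOn : ContinuousOn u (Ici 0)
  acLoc : ACLoc u
  ae_lt_top : ∀ᵐ t : ℝ, 0 < t → E (u t) < ⊤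
  intervalIntegrable : ∀ a b : ℝ, 0 < a → a ≤ b →
    IntervalIntegrable (fun t => (E (u t)).toReal) volume a b
  evi : ∀ y : X, E y < ⊤ → ∀ a b : ℝ, 0 < a → a ≤ b →
    dist (u b) y ^ 2 - dist (u a) y ^ 2 ≤
      2 * ((b - a) * (E y).toReal - ∫ t in a..b, (E (u t)).toReal) +
        κ * ∫ t in a..b, dist (u t) y ^ 2

lemma continuousOn_dist_const {s : Set ℝ} (hγ : ContinuousOn γ s) (y : X) :
    ContinuousOn (fun t => dist (γ t) y) s :=
  (continuous_id.dist continuous_const).comp_continuousOn hγ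

lemma aemeasurable_comp_of_lowerSemicontinuous {β : Type*} [LinearOrder β] [TopologicalSpace β]
    [OrderTopology β] [SecondCountableTopology β] [MeasurableSpace β] [BorelSpace β] {f : X → β}
    (hf : LowerSemicontinuous f) (hab : a ≤ b) (hγ : ContinuousOn γ (Icc a b)) :
    AEMeasurable (fun t => f (γ t)) (volume.restrict (Icc a b)) := by
  have hc : Continuous (IccExtend hab (domRestrict (Icc a b) γ)) :=
    (continuousOn_iff_continuous_domRestrict.1 hγ).Icc_extend'
  refine ⟨fun t => f (IccExtend hab (domRestrict (Icc a b) γ) t), (hf.comp hc).measurable, ?_⟩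
  filter_upwards [ae_restrict_mem measurableSet_Icc] with t ht
  rw [IccExtend_of_mem _ _ ht, domRestrict_apply]

namespace Setting

lemma coe_toReal (hE : Setting E) {x : X} (hx : E x < ⊤) : ((E x).toReal : EReal) = E x :=
  EReal.coe_toReal hx.ne (hE.ne_bot x)

lemma le_toReal (hE : Setting E) {x : X} {c : ℝ} (hx : E x < ⊤) (h : (c : EReal) ≤ E x) :
    c ≤ (E x).toReal := by
  rw [← hE.coe_toReal hx] at h
  exact_mod_cast h

lemma exists_lt_top (hE : Setting E) (x : X) : ∃ y, E y < ⊤ :=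
  hE.dense_domain.nonempty_iff.2 ⟨x⟩

lemma exists_lower_bound (hE : Setting E) (hγ : ContinuousOn γ (Icc a b)) :
    ∃ c : ℝ, ∀ t ∈ Icc a b, (c : EReal) ≤ E (γ t) := by
  obtain ⟨c, hc⟩ := hE.bounded_below _ (isCompact_Icc.image_of_continuousOn hγ).isBounded
  exact ⟨c, fun t ht => hc _ (mem_image_of_mem γ ht)⟩

lemma lt_top_and_le_of_evi (hE : Setting E) {lam D : ℝ} {p y : X} (hκ : -lam ≤ κ) (hy : E y < ⊤)
    (h : ((1 / 2 * D + lam / 2 * dist p y ^ 2 : ℝ) : EReal) + E p ≤ E y) :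
    E p < ⊤ ∧ D ≤ 2 * ((E y).toReal - (E p).toReal) + κ * dist p y ^ 2 := by
  have hp : E p < ⊤ := by
    by_contra hp
    rw [not_lt_top_iff.1 hp, EReal.coe_add_top] at h
    exact absurd hy (not_lt.2 h)
  refine ⟨hp, ?_⟩
  rw [← hE.coe_toReal hp, ← hE.coe_toReal hy] at h
  have hreal : 1 / 2 * D + lam / 2 * dist p y ^ 2 + (E p).toReal ≤ (E y).toReal := by
    exact_mod_cast h
  linarith [mul_le_mul_of_nonneg_right hκ (sq_nonneg (dist p y))]

end Setting

namespace IsEVIFlow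

variable {lam : ℝ}

lemma ae_deriv_dist_sq_le (hE : Setting E) (hκ : -lam ≤ κ) (hu : IsEVIFlow E lam u) {y : X}
    (hy : E y < ⊤) : ∀ᵐ t : ℝ, 0 < t → E (u t) < ⊤ ∧
      deriv (fun s => dist (u s) y ^ 2) t ≤
        2 * ((E y).toReal - (E (u t)).toReal) + κ * dist (u t) y ^ 2 := by
  filter_upwards [(ae_restrict_iff' measurableSet_Ioi).1 (hu.2 y)] with t ht htpos
  obtain ⟨D, hD, hle⟩ := ht htpos
  rw [hD.deriv]
  exact hE.lt_top_and_le_of_evi hκ hy hle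

end IsEVIFlow

lemma ACOn.absolutelyContinuousOnInterval_dist_sq (hab : a ≤ b) (h : ACOn γ a b) (y : X) :
    AbsolutelyContinuousOnInterval (fun t => dist (γ t) y ^ 2) a b := by
  have hdist := absolutelyContinuousOnInterval_dist_const (h.absolutelyContinuousOnInterval hab) y
  simpa only [sq] using hdist.fun_mul hdist

namespace IsEVIFlow

variable {lam : ℝ}

lemma intervalIntegrable_toReal (hE : Setting E) (hu : IsEVIFlow E lam u) (ha : 0 < a)
    (hab : a ≤ b) : IntervalIntegrable (fun t => (E (u t)).toReal) volume a b := by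
  rcases hab.eq_or_lt with rfl | hlt
  · exact .refl
  have hac := hu.1 a b ha hlt
  have hc := hac.continuousOn hab
  obtain ⟨c, hlow⟩ := hE.exists_lower_bound hc
  obtain ⟨y, hy⟩ := hE.exists_lt_top (u 0)
  have hkey := ae_deriv_dist_sq_le hE le_rfl hu hy
  have hup : IntervalIntegrable (fun t => (E y).toReal -
      1 / 2 * deriv (fun s => dist (u s) y ^ 2) t + -lam / 2 * dist (u t) y ^ 2) volume a b :=
    (intervalIntegrable_const.sub
      ((hac.absolutelyContinuousOnInterval_dist_sq hab y).intervalIntegrable_deriv.const_mul _)).add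
      ((((continuousOn_dist_const hc y).pow 2).intervalIntegrable_of_Icc hab).const_mul _)
  rw [intervalIntegrable_iff_integrableOn_Icc_of_le hab] at hup ⊢
  refine integrable_of_le_of_le (measurable_ereal_toReal.comp_aemeasurable
    (aemeasurable_comp_of_lowerSemicontinuous hE.lsc hab hc)).aestronglyMeasurable
    ?_ ?_ (integrableOn_const (C := c) (by simp)) hup
  · filter_upwards [ae_restrict_of_ae hkey, ae_restrict_mem measurableSet_Icc] with t ht hmem
    exact hE.le_toReal (ht (ha.trans_le hmem.1)).1 (hlow t hmem)
  · filter_upwards [ae_restrict_of_ae hkey, ae_restrict_mem measurableSet_Icc] with t ht hmem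
    linarith [(ht (ha.trans_le hmem.1)).2]

lemma dist_sq_sub_le (hE : Setting E) (hκ : -lam ≤ κ) (hu : IsEVIFlow E lam u) {y : X}
    (hy : E y < ⊤) (ha : 0 < a) (hab : a ≤ b) :
    dist (u b) y ^ 2 - dist (u a) y ^ 2 ≤
      2 * ((b - a) * (E y).toReal - ∫ t in a..b, (E (u t)).toReal) +
        κ * ∫ t in a..b, dist (u t) y ^ 2 := by
  rcases hab.eq_or_lt with rfl | hlt
  · simp
  have hac := hu.1 a b ha hlt
  have hsq := hac.absolutelyContinuousOnInterval_dist_sq hab y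
  have hint := hu.intervalIntegrable_toReal hE ha hab
  have henergy := (intervalIntegrable_const (c := (E y).toReal)).sub hint |>.const_mul 2
  have hdist : IntervalIntegrable (fun t => κ * dist (u t) y ^ 2) volume a b :=
    (((continuousOn_dist_const (hac.continuousOn hab) y).pow 2).intervalIntegrable_of_Icc
      hab).const_mul κ
  calc dist (u b) y ^ 2 - dist (u a) y ^ 2
      = ∫ t in a..b, deriv (fun s => dist (u s) y ^ 2) t := hsq.integral_deriv_eq_sub.symm
    _ ≤ ∫ t in a..b, (2 * ((E y).toReal - (E (u t)).toReal) + κ * dist (u t) y ^ 2) := by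
        refine intervalIntegral.integral_mono_ae_restrict hab hsq.intervalIntegrable_deriv
          (henergy.add hdist) ?_
        filter_upwards [ae_restrict_of_ae (ae_deriv_dist_sq_le hE hκ hu hy),
          ae_restrict_mem measurableSet_Icc] with t ht hmem using (ht (ha.trans_le hmem.1)).2
    _ = _ := by
        rw [intervalIntegral.integral_add henergy hdist, intervalIntegral.integral_const_mul,
          intervalIntegral.integral_const_mul,
          intervalIntegral.integral_sub intervalIntegrable_const hint,
          intervalIntegral.integral_const, smul_eq_mul]

lemma isIntegralFlow (hE : Setting E) (hκ : 0 ≤ κ) (hlam : -lam ≤ κ) (hu : IsEVIFlow E lam u)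
    (hc : ContinuousOn u (Ici 0)) : IsIntegralFlow E κ u where
  nonneg := hκ
  continuousOn := hc
  acLoc := hu.1
  ae_lt_top := by
    obtain ⟨y, hy⟩ := hE.exists_lt_top (u 0)
    filter_upwards [ae_deriv_dist_sq_le hE hlam hu hy] with t ht htpos using (ht htpos).1
  intervalIntegrable _ _ ha hab := hu.intervalIntegrable_toReal hE ha hab
  evi _ hy _ _ ha hab := hu.dist_sq_sub_le hE hlam hy ha hab

lemma congr (hu : IsEVIFlow E lam u) (h : ∀ t, 0 < t → w t = u t) : IsEVIFlow E lam w := by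
  refine ⟨fun a b ha hab => ?_, fun y => ?_⟩
  · obtain ⟨m, hm, hd⟩ := hu.1 a b ha hab
    refine ⟨m, hm, fun s t hs hst ht => ?_⟩
    rw [h s (ha.trans_le hs), h t (ha.trans_le (hs.trans hst))]
    exact hd s t hs hst ht
  · filter_upwards [hu.2 y, ae_restrict_mem measurableSet_Ioi] with t ht htpos
    obtain ⟨D, hD, hle⟩ := ht
    refine ⟨D, hD.congr_of_eventuallyEq ?_, by rwa [h t htpos]⟩
    filter_upwards [lt_mem_nhds htpos] with s hs
    rw [h s hs]

end IsEVIFlow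

lemma ACLoc.continuousAt (h : ACLoc u) {t : ℝ} (ht : 0 < t) : ContinuousAt u t :=
  ((h (t / 2) (t + 1) (by linarith) (by linarith)).continuousOn (by linarith)).continuousAt
    (Icc_mem_nhds (by linarith) (by linarith))

lemma Setting.exists_isIntegralFlow (hE : Setting E) :
    ∃ κ : ℝ, ∀ x : X, ∃ u : ℝ → X, IsIntegralFlow E κ u ∧ u 0 = x := by
  obtain ⟨lam, hflow⟩ := hE.flow
  refine ⟨max (-lam) 0, fun x => ?_⟩
  obtain ⟨γ, hγ, -, hγx⟩ := hflow x
  have hpos : ∀ t, 0 < t → Function.update γ 0 x t = γ t := fun t ht =>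
    Function.update_of_ne ht.ne' x γ
  have hu : IsEVIFlow E lam (Function.update γ 0 x) := hγ.congr hpos
  refine ⟨Function.update γ 0 x, hu.isIntegralFlow hE (le_max_right _ _) (le_max_left _ _) ?_,
    Function.update_self _ _ _⟩
  intro t ht
  rcases (mem_Ici.1 ht).eq_or_lt with rfl | htpos
  · rw [← Ioi_insert, continuousWithinAt_insert_self, ContinuousWithinAt, Function.update_self]
    exact hγx.congr' (eventually_mem_nhdsWithin.mono fun s hs => (hpos s hs).symm)
  · exact (hu.1.continuousAt htpos).continuousWithinAt

end IntegralFlow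

section Contraction

variable {X : Type*} [MetricSpace X] {E : X → EReal} {κ : ℝ} {u w : ℝ → X} {a b : ℝ}

lemma continuousOn_dist_sq {s : Set ℝ} (hu : ContinuousOn u s) (hw : ContinuousOn w s) :
    ContinuousOn (fun t => dist (u t) (w t) ^ 2) s :=
  (continuous_dist.comp_continuousOn (hu.prodMk hw)).pow 2

lemma exists_dist_sq_le_add (hu : ContinuousOn u (Icc a b)) (hw : ContinuousOn w (Icc a b))
    {δ : ℝ} (hδ : 0 < δ) : ∃ η > 0, ∀ t ∈ Icc a b, ∀ p ∈ Icc a b, ∀ q ∈ Icc a b,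
      dist p t < η → dist q t < η → dist (u p) (w q) ^ 2 ≤ dist (u t) (w t) ^ 2 + δ := by
  have hcont : ContinuousOn (fun z : ℝ × ℝ => dist (u z.1) (w z.2) ^ 2) (Icc a b ×ˢ Icc a b) :=
    (continuous_dist.comp_continuousOn ((hu.comp continuousOn_fst fun _ hz => hz.1).prodMk
      (hw.comp continuousOn_snd fun _ hz => hz.2))).pow 2
  obtain ⟨η, hη, h⟩ := Metric.uniformContinuousOn_iff.1
    ((isCompact_Icc.prod isCompact_Icc).uniformContinuousOn_of_continuous hcont) δ hδ
  refine ⟨η, hη, fun t ht p hp q hq hpt hqt => ?_⟩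
  have := (le_abs_self _).trans_lt (h (p, q) ⟨hp, hq⟩ (t, t) ⟨ht, ht⟩ (max_lt hpt hqt))
  linarith

namespace IsIntegralFlow

lemma continuousOn_Icc (hu : IsIntegralFlow E κ u) (ha : 0 ≤ a) : ContinuousOn u (Icc a b) :=
  hu.continuousOn.mono fun _ ht => ha.trans ht.1

lemma integral_dist_sq_le (hu : IsIntegralFlow E κ u) (ha : 0 ≤ a) (hab : a ≤ b) {y : X} {M : ℝ}
    (hM : ∀ r ∈ Icc a b, dist (u r) y ^ 2 ≤ M) :
    κ * ∫ r in a..b, dist (u r) y ^ 2 ≤ κ * ((b - a) * M) := by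
  refine mul_le_mul_of_nonneg_left ?_ hu.nonneg
  calc ∫ r in a..b, dist (u r) y ^ 2 ≤ ∫ _ in a..b, M :=
        intervalIntegral.integral_mono_on hab
          (((continuousOn_dist_const (hu.continuousOn_Icc ha) y).pow 2).intervalIntegrable_of_Icc
            hab) intervalIntegrable_const hM
    _ = (b - a) * M := by rw [intervalIntegral.integral_const, smul_eq_mul]

/-- The two inequalities are tested at `w b` and at `u a`. -/
lemma dist_sq_increment_le (hu : IsIntegralFlow E κ u) (hw : IsIntegralFlow E κ w) (ha : 0 < a)
    (hab : a ≤ b) (hEu : E (u a) < ⊤) (hEw : E (w b) < ⊤) {M : ℝ}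
    (hMu : ∀ r ∈ Icc a b, dist (u r) (w b) ^ 2 ≤ M)
    (hMw : ∀ r ∈ Icc a b, dist (u a) (w r) ^ 2 ≤ M) :
    dist (u b) (w b) ^ 2 - dist (u a) (w a) ^ 2 ≤
      2 * ((b - a) * ((E (u a)).toReal + (E (w b)).toReal) - (∫ r in a..b, (E (u r)).toReal) -
        ∫ r in a..b, (E (w r)).toReal) + 2 * κ * ((b - a) * M) := by
  have hu' := (hu.evi _ hEw a b ha hab).trans
    (add_le_add_right (hu.integral_dist_sq_le ha.le hab hMu) _)
  have hw' := (hw.evi _ hEu a b ha hab).trans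
    (add_le_add_right (hw.integral_dist_sq_le ha.le hab fun r hr => by
      rw [dist_comm]; exact hMw r hr) _)
  rw [dist_comm (w b), dist_comm (w a)] at hw'
  linarith

lemma intervalIntegrable_of_mem (hu : IsIntegralFlow E κ u) {s t : ℝ} (hs : 0 < s) (ht : 0 < t) :
    IntervalIntegrable (fun r => (E (u r)).toReal) volume s t := by
  rcases le_total s t with h | h
  · exact hu.intervalIntegrable s t hs h
  · exact (hu.intervalIntegrable t s ht h).symm

lemma eventually_ae_dist_sq_increment_le (hu : IsIntegralFlow E κ u) (hw : IsIntegralFlow E κ w)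
    (ha : 0 < a) {δ : ℝ} (hδ : 0 < δ) : ∀ᶠ h in 𝓝[>] (0 : ℝ), ∀ᵐ t, t ∈ Icc a b →
      dist (u t) (w t) ^ 2 - dist (u (t - h)) (w (t - h)) ^ 2 ≤
        h * (2 * (E (u (t - h))).toReal +
          (2 * (E (w t)).toReal + 2 * κ * (dist (u t) (w t) ^ 2 + δ))) -
        2 * ((∫ r in t - h..t, (E (u r)).toReal) + ∫ r in t - h..t, (E (w r)).toReal) := by
  obtain ⟨c, hc, hca⟩ := exists_between ha
  obtain ⟨η, hη, hosc⟩ := exists_dist_sq_le_add (b := b) (hu.continuousOn_Icc hc.le)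
    (hw.continuousOn_Icc hc.le) hδ
  filter_upwards [Ioo_mem_nhdsGT (lt_min hη (sub_pos.2 hca))] with h hh
  have hhη : h < η := hh.2.trans_le (min_le_left _ _)
  have hhc : h < a - c := hh.2.trans_le (min_le_right _ _)
  filter_upwards [hw.ae_lt_top,
    (measurePreserving_sub_right volume h).quasiMeasurePreserving.ae hu.ae_lt_top]
    with t hwt hut ht
  have hct : c < t - h := by linarith [ht.1]
  have hmem : ∀ r ∈ Icc (t - h) t, r ∈ Icc c b ∧ dist r t < η := fun r hr => by
    refine ⟨⟨hct.le.trans hr.1, hr.2.trans ht.2⟩, ?_⟩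
    rw [Real.dist_eq, abs_lt]
    constructor <;> linarith [hr.1, hr.2]
  have hth : t - h ≤ t := by linarith [hh.1]
  obtain ⟨htm, htd⟩ := hmem t (right_mem_Icc.2 hth)
  obtain ⟨hthm, hthd⟩ := hmem (t - h) (left_mem_Icc.2 hth)
  have hinc := hu.dist_sq_increment_le hw (hc.trans hct) hth (hut (hc.trans hct))
    (hwt (ha.trans_le ht.1))
    (fun r hr => hosc t htm r (hmem r hr).1 t htm (hmem r hr).2 htd)
    (fun r hr => hosc t htm (t - h) hthm r (hmem r hr).1 hthd (hmem r hr).2)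
  linarith

lemma dist_sq_sub_le_add (hu : IsIntegralFlow E κ u) (hw : IsIntegralFlow E κ w) (ha : 0 < a)
    (hab : a ≤ b) {δ : ℝ} (hδ : 0 < δ) : dist (u b) (w b) ^ 2 - dist (u a) (w a) ^ 2 ≤
      2 * κ * ∫ t in a..b, (dist (u t) (w t) ^ 2 + δ) := by
  have hc : 0 < a / 2 := half_pos ha
  have hcb : a / 2 ≤ b := (half_le_self ha.le).trans hab
  have hdiff : ∀ {v}, IsIntegralFlow E κ v → ∀ {s t}, 0 < s → 0 < t →
      (∫ r in a / 2..t, (E (v r)).toReal) - ∫ r in a / 2..s, (E (v r)).toReal =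
        ∫ r in s..t, (E (v r)).toReal := fun hv _ _ hs ht =>
    intervalIntegral.integral_interval_sub_left (hv.intervalIntegrable_of_mem hc ht)
      (hv.intervalIntegrable_of_mem hc hs)
  have hFu := hu.intervalIntegrable _ b hc hcb
  have hFw := hw.intervalIntegrable _ b hc hcb
  have hGw := (hw.intervalIntegrable a b ha hab).const_mul 2
  have hδint : IntervalIntegrable (fun t => 2 * κ * (dist (u t) (w t) ^ 2 + δ)) volume a b :=
    (((continuousOn_dist_sq (hu.continuousOn_Icc ha.le) (hw.continuousOn_Icc ha.le)).add
      continuousOn_const).intervalIntegrable_of_Icc hab).const_mul _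
  have hsum := sub_le_integral_add_integral_of_increment_le
    (H := fun t => dist (u t) (w t) ^ 2 +
      2 * ((∫ r in a / 2..t, (E (u r)).toReal) + ∫ r in a / 2..t, (E (w r)).toReal))
    (half_lt_self ha) hab
    ((continuousOn_dist_sq (hu.continuousOn_Icc hc.le) (hw.continuousOn_Icc hc.le)).add
      (continuousOn_const.mul
        ((continuousOn_primitive_Icc hcb hFu).add (continuousOn_primitive_Icc hcb hFw))))
    (hFu.const_mul 2) (hGw.add hδint) (by
      filter_upwards [hu.eventually_ae_dist_sq_increment_le hw ha hδ, Ioo_mem_nhdsGT ha]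
        with h hinc hh
      filter_upwards [hinc] with t ht hmem
      have hpos : 0 < t - h := by linarith [hmem.1, hh.2]
      have hle := ht hmem
      rw [← hdiff hu hpos (ha.trans_le hmem.1), ← hdiff hw hpos (ha.trans_le hmem.1)] at hle
      linarith)
  rw [intervalIntegral.integral_add hGw hδint, intervalIntegral.integral_const_mul,
    intervalIntegral.integral_const_mul, intervalIntegral.integral_const_mul,
    ← hdiff hu ha (ha.trans_le hab), ← hdiff hw ha (ha.trans_le hab)] at hsum
  linarith

lemma dist_sq_le (hu : IsIntegralFlow E κ u) (hw : IsIntegralFlow E κ w) (ha : 0 < a)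
    (hab : a ≤ b) :
    dist (u b) (w b) ^ 2 ≤ Real.exp (2 * κ * (b - a)) * dist (u a) (w a) ^ 2 := by
  have hc : ∀ b, ContinuousOn (fun t => dist (u t) (w t) ^ 2) (Icc a b) := fun b =>
    continuousOn_dist_sq (hu.continuousOn_Icc ha.le) (hw.continuousOn_Icc ha.le)
  refine le_exp_mul_of_le_add_integral (f := fun t => dist (u t) (w t) ^ 2) hab
    (mul_nonneg zero_le_two hu.nonneg) (hc b) fun t ht => ?_
  have hlim : Tendsto (fun δ : ℝ => dist (u a) (w a) ^ 2 +
      2 * κ * ((∫ r in a..t, dist (u r) (w r) ^ 2) + (t - a) * δ)) (𝓝[>] 0)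
      (𝓝 (dist (u a) (w a) ^ 2 +
        2 * κ * ((∫ r in a..t, dist (u r) (w r) ^ 2) + (t - a) * 0))) :=
    (by fun_prop : Continuous fun δ : ℝ => dist (u a) (w a) ^ 2 +
      2 * κ * ((∫ r in a..t, dist (u r) (w r) ^ 2) + (t - a) * δ)).continuousWithinAt
  rw [mul_zero, add_zero] at hlim
  refine ge_of_tendsto hlim (eventually_mem_nhdsWithin.mono fun δ hδ => ?_)
  have h := hu.dist_sq_sub_le_add hw ha ht.1 hδ
  rw [intervalIntegral.integral_add ((hc t).intervalIntegrable_of_Icc ht.1)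
    intervalIntegrable_const, intervalIntegral.integral_const, smul_eq_mul] at h
  linarith

lemma dist_le (hu : IsIntegralFlow E κ u) (hw : IsIntegralFlow E κ w) (ha : 0 ≤ a)
    (hab : a ≤ b) : dist (u b) (w b) ≤ Real.exp (κ * (b - a)) * dist (u a) (w a) := by
  have hpos : ∀ s, 0 < s → s ≤ b →
      dist (u b) (w b) ≤ Real.exp (κ * (b - s)) * dist (u s) (w s) := fun s hs hsb => by
    refine le_of_sq_le_sq ?_ (by positivity)
    rw [mul_pow, ← Real.exp_nat_mul, Nat.cast_ofNat, ← mul_assoc]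
    exact hu.dist_sq_le hw hs hsb
  rcases ha.eq_or_lt with rfl | ha
  · rcases hab.eq_or_lt with rfl | hb
    · simp
    have hlim : ContinuousWithinAt (fun s => Real.exp (κ * (b - s)) * dist (u s) (w s)) (Ioi 0) 0 :=
      ((by fun_prop : Continuous fun s => Real.exp (κ * (b - s))).continuousWithinAt).mul
        (((hu.continuousOn 0 self_mem_Ici).mono Ioi_subset_Ici_self).dist
          ((hw.continuousOn 0 self_mem_Ici).mono Ioi_subset_Ici_self))
    refine ge_of_tendsto hlim ?_
    filter_upwards [Ioc_mem_nhdsGT hb] with s hs using hpos s hs.1 hs.2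
  · exact hpos a ha hab

end IsIntegralFlow

end Contraction

/-! ### Slope and gradient flows -/

section Slope

variable {X : Type*} [MetricSpace X] {E : X → EReal} {κ : ℝ} {x y : X}

lemma lt_top_of_metricSlope_lt_top (h : metricSlope E x < ⊤) : E x < ⊤ := by
  by_contra hx
  rw [metricSlope, if_neg (show x ∉ domain E from hx)] at h
  exact lt_irrefl _ h

lemma toENNReal_sub_div_edist_le_iff (hE : ∀ x, E x ≠ ⊥) (hx : E x < ⊤) (hxy : x ≠ y) {p : ℝ}
    (hp : 0 ≤ p) : (E x - E y).toENNReal / edist x y ≤ ENNReal.ofReal p ↔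
      (((E x).toReal - p * dist x y : ℝ) : EReal) ≤ E y := by
  rw [edist_dist, ENNReal.div_le_iff_le_mul (.inl (by simpa using hxy))
    (.inl ENNReal.ofReal_ne_top), ← ENNReal.ofReal_mul hp, ← EReal.coe_toReal hx.ne (hE x)]
  by_cases hy : E y < ⊤
  · rw [← EReal.coe_toReal hy.ne (hE y), ← EReal.coe_sub,
      EReal.toENNReal_of_ne_top (EReal.coe_ne_top _), EReal.toReal_coe, EReal.toReal_coe,
      ENNReal.ofReal_le_ofReal_iff (by positivity), EReal.coe_le_coe_iff]
    exact sub_le_comm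
  · rw [not_lt_top_iff.1 hy, EReal.sub_top]
    simp

lemma eventually_sub_mul_dist_le (hE : ∀ x, E x ≠ ⊥) {p : ℝ}
    (h : metricSlope E x < ENNReal.ofReal p) :
    ∀ᶠ y in 𝓝 x, (((E x).toReal - p * dist x y : ℝ) : EReal) ≤ E y := by
  have hp : 0 < p := ENNReal.ofReal_pos.1 (bot_le.trans_lt h)
  have hx := lt_top_of_metricSlope_lt_top (h.trans ENNReal.ofReal_lt_top)
  rw [metricSlope, if_pos (show x ∈ domain E from hx)] at h
  filter_upwards [eventually_nhdsWithin_iff.1 (eventually_lt_of_limsup_lt h)] with y hy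
  rcases eq_or_ne x y with rfl | hxy
  · rw [dist_self, mul_zero, sub_zero, EReal.coe_toReal hx.ne (hE x)]
  · exact (toENNReal_sub_div_edist_le_iff hE hx hxy hp.le).1 (hy hxy.symm).le

lemma metricSlope_le_of_energy_le (hE : ∀ x, E x ≠ ⊥) (hx : E x < ⊤) {q : ℝ} (hq : 0 ≤ q)
    (h : ∀ y, E y < ⊤ → (E x).toReal ≤ (E y).toReal + q * dist x y + κ / 2 * dist x y ^ 2) :
    metricSlope E x ≤ ENNReal.ofReal q := by
  have hgt : ∀ p > q, metricSlope E x ≤ ENNReal.ofReal p := by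
    intro p hp
    rw [metricSlope, if_pos (show x ∈ domain E from hx)]
    refine limsup_le_of_le (h := ?_)
    have hnear : ∀ᶠ y in 𝓝 x, q + κ / 2 * dist x y < p := by
      have hc : Continuous fun y => q + κ / 2 * dist x y := by fun_prop
      exact hc.continuousAt.eventually_lt_const (by simpa using hp)
    filter_upwards [mem_nhdsWithin_of_mem_nhds hnear, self_mem_nhdsWithin] with y hy hne
    rw [toENNReal_sub_div_edist_le_iff hE hx (Ne.symm hne) (hq.trans hp.le)]
    by_cases hyt : E y < ⊤
    · rw [← EReal.coe_toReal hyt.ne (hE y), EReal.coe_le_coe_iff]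
      nlinarith [h y hyt, dist_pos.2 (Ne.symm hne)]
    · rw [not_lt_top_iff.1 hyt]
      exact le_top
  have hlim : Tendsto ENNReal.ofReal (𝓝[>] q) (𝓝 (ENNReal.ofReal q)) :=
    ENNReal.continuous_ofReal.continuousWithinAt
  exact ge_of_tendsto hlim (eventually_mem_nhdsWithin.mono hgt)

end Slope

section FlowSlope

variable {X : Type*} [MetricSpace X] {E : X → EReal} {κ : ℝ} {u w : ℝ → X}

namespace IsIntegralFlow

lemma shift (hu : IsIntegralFlow E κ u) {τ : ℝ} (hτ : 0 ≤ τ) :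
    IsIntegralFlow E κ (fun t => u (t + τ)) where
  nonneg := hu.nonneg
  continuousOn := hu.continuousOn.comp (by fun_prop) fun _ ht => add_nonneg ht hτ
  acLoc a b ha hab := by
    obtain ⟨m, hm, hd⟩ := hu.acLoc (a + τ) (b + τ) (by linarith) (by linarith)
    refine ⟨fun t => m (t + τ), ?_, fun s t hs hst ht => ?_⟩
    · rw [← intervalIntegrable_iff_integrableOn_Icc_of_le (by linarith)] at hm ⊢
      simpa using hm.comp_add_right τ
    · rw [intervalIntegral.integral_comp_add_right]
      exact hd _ _ (by linarith) (by linarith) (by linarith)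
  ae_lt_top := by
    filter_upwards [(measurePreserving_add_right volume τ).quasiMeasurePreserving.ae hu.ae_lt_top]
      with t ht htpos using ht (by linarith)
  intervalIntegrable a b ha hab := by
    simpa using
      (hu.intervalIntegrable (a + τ) (b + τ) (by linarith) (by linarith)).comp_add_right τ
  evi y hy a b ha hab := by
    have h := hu.evi y hy (a + τ) (b + τ) (by linarith) (by linarith)
    rw [intervalIntegral.integral_comp_add_right (fun t => (E (u t)).toReal),
      intervalIntegral.integral_comp_add_right (fun t => dist (u t) y ^ 2)]
    rwa [add_sub_add_right_eq_sub] at h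

lemma tendsto_zero (hu : IsIntegralFlow E κ u) : Tendsto u (𝓝[>] 0) (𝓝 (u 0)) :=
  (hu.continuousOn 0 self_mem_Ici).mono Ioi_subset_Ici_self

lemma dist_sq_sub_le_of_minorant (hE : Setting E) (hu : IsIntegralFlow E κ u) {y : X}
    (hy : E y < ⊤) {t : ℝ} (ht : 0 < t) {φ : ℝ → ℝ} (hφ : IntervalIntegrable φ volume 0 t)
    (hle : ∀ r ∈ Ioc 0 t, (φ r : EReal) ≤ E (u r)) :
    dist (u t) y ^ 2 - dist (u 0) y ^ 2 ≤
      2 * (t * (E y).toReal - ∫ r in (0 : ℝ)..t, φ r) +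
        κ * ∫ r in (0 : ℝ)..t, dist (u r) y ^ 2 := by
  have hsq : ContinuousOn (fun r => dist (u r) y ^ 2) (Icc 0 t) :=
    (continuousOn_dist_const (hu.continuousOn_Icc le_rfl) y).pow 2
  have hsqi : IntervalIntegrable (fun r => dist (u r) y ^ 2) volume 0 t :=
    hsq.intervalIntegrable_of_Icc ht.le
  have hcont : ContinuousOn (fun a => dist (u a) y ^ 2 +
      (2 * ((t - a) * (E y).toReal - ((∫ r in (0 : ℝ)..t, φ r) - ∫ r in (0 : ℝ)..a, φ r)) +
        κ * ((∫ r in (0 : ℝ)..t, dist (u r) y ^ 2) - ∫ r in (0 : ℝ)..a, dist (u r) y ^ 2)))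
      (Icc 0 t) := by
    have hP := continuousOn_primitive_Icc ht.le hφ
    have hQ := continuousOn_primitive_Icc ht.le hsqi
    fun_prop
  have hlim := ((hcont 0 (left_mem_Icc.2 ht.le)).mono Ioc_subset_Icc_self).tendsto
  rw [nhdsWithin_Ioc_eq_nhdsGT ht] at hlim
  simp only [intervalIntegral.integral_same, sub_zero] at hlim
  rw [sub_le_iff_le_add']
  refine ge_of_tendsto hlim ?_
  filter_upwards [Ioc_mem_nhdsGT ht] with a ha
  have hsub : ∀ {g : ℝ → ℝ}, IntervalIntegrable g volume 0 t →
      IntervalIntegrable g volume 0 a ∧ IntervalIntegrable g volume a t := fun hg =>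
    ⟨hg.mono_set (uIcc_subset_uIcc_left (by rw [uIcc_of_le ht.le]; exact Ioc_subset_Icc_self ha)),
      hg.mono_set (uIcc_subset_uIcc_right (by rw [uIcc_of_le ht.le]; exact Ioc_subset_Icc_self ha))⟩
  rw [intervalIntegral.integral_interval_sub_left hφ (hsub hφ).1,
    intervalIntegral.integral_interval_sub_left hsqi (hsub hsqi).1]
  have hmono := intervalIntegral.integral_mono_ae_restrict ha.2 (hsub hφ).2
    (hu.intervalIntegrable a t ha.1 ha.2) (by
      filter_upwards [ae_restrict_of_ae hu.ae_lt_top, ae_restrict_mem measurableSet_Icc]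
        with r hr hmem
      have hrpos := ha.1.trans_le hmem.1
      exact hE.le_toReal (hr hrpos) (hle r ⟨hrpos, hmem.2⟩))
  linarith [hu.evi y hy a t ha.1 ha.2]

lemma dist_sq_sub_le_of_bounds (hE : Setting E) (hu : IsIntegralFlow E κ u) {y : X}
    (hy : E y < ⊤) {t c M : ℝ} (ht : 0 < t) (hc : ∀ r ∈ Ioc 0 t, (c : EReal) ≤ E (u r))
    (hM : ∀ r ∈ Icc 0 t, dist (u r) y ^ 2 ≤ M) :
    dist (u t) y ^ 2 - dist (u 0) y ^ 2 ≤ t * (2 * ((E y).toReal - c) + κ * M) := by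
  have h := hu.dist_sq_sub_le_of_minorant hE hy ht intervalIntegrable_const hc
  rw [intervalIntegral.integral_const, sub_zero, smul_eq_mul] at h
  linarith [hu.integral_dist_sq_le le_rfl ht.le hM]

lemma energy_le_of_rightSpeedLE (hE : Setting E) (hu : IsIntegralFlow E κ u) {q : ℝ}
    (hq : RightSpeedLE u 0 q) {y : X} (hy : E y < ⊤) :
    E (u 0) ≤ (((E y).toReal + q * dist (u 0) y + κ / 2 * dist (u 0) y ^ 2 : ℝ) : EReal) := by
  refine EReal.ge_of_forall_gt_iff_ge.1 fun c hc => EReal.coe_le_coe_iff.2 ?_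
  have hbound : ∀ M > dist (u 0) y ^ 2, c ≤ (E y).toReal + q * dist (u 0) y + κ / 2 * M := by
    intro M hM
    have hEc : ∀ᶠ t in 𝓝[>] (0 : ℝ), (c : EReal) < E (u t) :=
      hu.tendsto_zero.eventually (hE.lsc (u 0) c hc)
    have hdM : ∀ᶠ t in 𝓝[>] (0 : ℝ), dist (u t) y ^ 2 < M :=
      ((hu.tendsto_zero.dist tendsto_const_nhds).pow 2).eventually_lt_const hM
    obtain ⟨t, ht, h⟩ := exists_pos_forall_mem_Ioc (hEc.and (hdM.and hq))
    have hqt := (h t ⟨ht, le_rfl⟩).2.2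
    rw [sub_zero] at hqt
    have hevi := hu.dist_sq_sub_le_of_bounds hE hy ht (fun r hr => (h r hr).1.le) (M := M)
      (fun r hr => hr.1.eq_or_lt.elim (fun h0 => h0 ▸ hM.le) fun h0 => (h r ⟨h0, hr.2⟩).2.1.le)
    have htri : dist (u 0) y ≤ q * t + dist (u t) y := by
      linarith [dist_triangle_left (u 0) y (u t)]
    have hlow : t * (-(2 * q * dist (u 0) y)) ≤ dist (u t) y ^ 2 - dist (u 0) y ^ 2 := by
      nlinarith [mul_le_mul_of_nonneg_left htri (dist_nonneg (x := u 0) (y := y)),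
        sq_nonneg (dist (u t) y - dist (u 0) y)]
    linarith [le_of_mul_le_mul_left (hlow.trans hevi) ht]
  have hlim : Tendsto (fun M => (E y).toReal + q * dist (u 0) y + κ / 2 * M)
      (𝓝[>] (dist (u 0) y ^ 2))
      (𝓝 ((E y).toReal + q * dist (u 0) y + κ / 2 * dist (u 0) y ^ 2)) :=
    (by fun_prop : Continuous fun M =>
      (E y).toReal + q * dist (u 0) y + κ / 2 * M).continuousWithinAt
  exact ge_of_tendsto hlim (eventually_mem_nhdsWithin.mono hbound)

lemma rightSpeedLE_of_metricSlope_lt (hE : Setting E) (hu : IsIntegralFlow E κ u) {q : ℝ}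
    (h : metricSlope E (u 0) < ENNReal.ofReal q) : RightSpeedLE u 0 q := by
  have hx := lt_top_of_metricSlope_lt_top (h.trans ENNReal.ofReal_lt_top)
  obtain ⟨p, hp, hSp, hpq⟩ := ENNReal.lt_iff_exists_real_btwn.1 h
  rw [ENNReal.ofReal_lt_ofReal_iff_of_nonneg hp] at hpq
  have hslope := hu.tendsto_zero.eventually (eventually_sub_mul_dist_le hE.ne_bot hSp)
  have hdist : ∀ᶠ t in 𝓝[>] (0 : ℝ), κ / 2 * dist (u t) (u 0) < q - p := by
    have hlim := (hu.tendsto_zero.dist (tendsto_const_nhds (x := u 0))).const_mul (κ / 2)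
    rw [dist_self, mul_zero] at hlim
    exact hlim.eventually_lt_const (sub_pos.2 hpq)
  obtain ⟨T, hT, hnear⟩ := exists_pos_forall_mem_Ioc (hslope.and hdist)
  have hd : ∀ t, ContinuousOn (fun r => dist (u r) (u 0)) (Icc 0 t) := fun t =>
    continuousOn_dist_const (hu.continuousOn_Icc le_rfl) _
  filter_upwards [Ioc_mem_nhdsGT hT] with b hb
  rw [sub_zero]
  refine le_mul_of_sq_le_integral hb.1.le (hp.trans hpq.le) (hd b) (fun _ _ => dist_nonneg)
    fun t ht => ?_
  rcases ht.1.eq_or_lt with rfl | htpos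
  · simp
  have hmem : ∀ r ∈ Ioc 0 t, r ∈ Ioc 0 T := fun r hr => ⟨hr.1, hr.2.trans (ht.2.trans hb.2)⟩
  have hdi : IntervalIntegrable (fun r => dist (u r) (u 0)) volume 0 t :=
    (hd t).intervalIntegrable_of_Icc htpos.le
  have hsqi : IntervalIntegrable (fun r => dist (u r) (u 0) ^ 2) volume 0 t :=
    ((hd t).pow 2).intervalIntegrable_of_Icc htpos.le
  have hevi := hu.dist_sq_sub_le_of_minorant hE hx htpos
    (intervalIntegrable_const.sub (hdi.const_mul p)) fun r hr => by
      rw [dist_comm]; exact (hnear r (hmem r hr)).1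
  have hquad : κ * ∫ r in (0 : ℝ)..t, dist (u r) (u 0) ^ 2 ≤
      2 * (q - p) * ∫ r in (0 : ℝ)..t, dist (u r) (u 0) := by
    rw [← intervalIntegral.integral_const_mul, ← intervalIntegral.integral_const_mul]
    refine intervalIntegral.integral_mono_on htpos.le (hsqi.const_mul κ) (hdi.const_mul _)
      fun r hr => ?_
    rcases hr.1.eq_or_lt with rfl | hrpos
    · simp
    · nlinarith [(hnear r (hmem r ⟨hrpos, hr.2⟩)).2, dist_nonneg (x := u r) (y := u 0)]
  rw [intervalIntegral.integral_sub intervalIntegrable_const (hdi.const_mul p),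
    intervalIntegral.integral_const_mul, intervalIntegral.integral_const, dist_self,
    smul_eq_mul] at hevi
  linarith

lemma energy_le_of_metricSlope_lt_top (hE : Setting E) (hu : IsIntegralFlow E κ u)
    (hx : metricSlope E (u 0) < ⊤) {y : X} (hy : E y < ⊤) :
    (E (u 0)).toReal ≤ (E y).toReal + (metricSlope E (u 0)).toReal * dist (u 0) y +
      κ / 2 * dist (u 0) y ^ 2 := by
  have hlim : Tendsto (fun q => (E y).toReal + q * dist (u 0) y + κ / 2 * dist (u 0) y ^ 2)
      (𝓝[>] (metricSlope E (u 0)).toReal) (𝓝 ((E y).toReal +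
        (metricSlope E (u 0)).toReal * dist (u 0) y + κ / 2 * dist (u 0) y ^ 2)) :=
    (by fun_prop : Continuous fun q =>
      (E y).toReal + q * dist (u 0) y + κ / 2 * dist (u 0) y ^ 2).continuousWithinAt
  refine ge_of_tendsto hlim (eventually_mem_nhdsWithin.mono fun q hq => ?_)
  have h := hu.energy_le_of_rightSpeedLE hE (hu.rightSpeedLE_of_metricSlope_lt hE
    ((ENNReal.lt_ofReal_iff_toReal_lt hx.ne).2 hq)) hy
  rwa [← hE.coe_toReal (lt_top_of_metricSlope_lt_top hx), EReal.coe_le_coe_iff] at h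

end IsIntegralFlow

end FlowSlope

/-! ### Regularity and energy dissipation -/

section FlowRegularity

variable {X : Type*} [MetricSpace X] {E : X → EReal} {κ : ℝ} {u : ℝ → X} {a b s t q : ℝ}

lemma ACLoc.exists_rightSpeedLE (h : ACLoc u) (ha : 0 < a) (hab : a < b) :
    ∃ s ∈ Ioo a b, ∃ C : ℝ, RightSpeedLE u s C := by
  obtain ⟨m, hm⟩ := h a b ha hab
  have hne : (ae (volume.restrict (Ioo a b))).NeBot := by
    rw [ae_neBot, Ne, Measure.restrict_eq_zero, Real.volume_Ioo]
    simpa using hab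
  obtain ⟨s, hspeed, hs⟩ := (((ae_restrict_iff' measurableSet_Ioo).2
    (IsSpeedBound.metricSpeed_le hab.le hm)).and (ae_restrict_mem measurableSet_Ioo)).exists
  refine ⟨s, hs, |m s| + 1, rightSpeedLE_of_metricSpeed_lt (hspeed.trans_lt ?_)⟩
  exact (ENNReal.ofReal_lt_ofReal_iff (by positivity)).2 (lt_add_one _)

lemma lipschitzOnWith_Icc_of_rightSpeedLE {C : ℝ≥0} (hu : ContinuousOn u (Icc a b))
    (h : ∀ t ∈ Ico a b, RightSpeedLE u t C) : LipschitzOnWith C u (Icc a b) := by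
  have hle : ∀ s ∈ Icc a b, ∀ t ∈ Icc s b, dist (u t) (u s) ≤ C * (t - s) := by
    intro s hs
    refine image_le_of_liminf_slope_right_le_deriv_boundary
      (continuousOn_dist_const (hu.mono (Icc_subset_Icc_left hs.1)) (u s))
      (by simp) (by fun_prop) (B' := fun _ => (C : ℝ)) (fun r _ => ?_) (fun r hr c hc => ?_)
    · simpa using (((hasDerivAt_id r).sub_const s).const_mul (C : ℝ)).hasDerivWithinAt (s := Ici r)
    · refine Eventually.frequently ?_
      filter_upwards [h r ⟨hs.1.trans hr.1, hr.2⟩, self_mem_nhdsWithin] with z hz hzr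
      have hpos : 0 < z - r := sub_pos.2 hzr
      rw [slope_def_field, div_lt_iff₀ hpos]
      linarith [dist_triangle (u z) (u r) (u s), mul_lt_mul_of_pos_right hc hpos]
  refine LipschitzOnWith.of_dist_le_mul fun s hs t ht => ?_
  rw [Real.dist_eq]
  rcases le_total s t with hst | hst
  · rw [dist_comm, abs_sub_comm, abs_of_nonneg (sub_nonneg.2 hst)]
    exact hle s hs t ⟨hst, ht.2⟩
  · rw [abs_of_nonneg (sub_nonneg.2 hst)]
    exact hle t ht s ⟨hst, hs.2⟩

lemma rightSpeedLE_of_lipschitzOnWith {C : ℝ≥0} (hC : LipschitzOnWith C u (Icc a b))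
    (ht : t ∈ Ico a b) : RightSpeedLE u t C := by
  filter_upwards [Ioc_mem_nhdsGT ht.2] with s hs
  have := hC.dist_le_mul s ⟨ht.1.trans hs.1.le, hs.2⟩ t (Ico_subset_Icc_self ht)
  rwa [Real.dist_eq, abs_of_pos (sub_pos.2 hs.1)] at this

namespace IsIntegralFlow

/-- Contraction, applied to the flow and to its own time shift. -/
lemma rightSpeedLE_of_le (hu : IsIntegralFlow E κ u) (hs : 0 ≤ s) (hst : s ≤ t)
    (hq : RightSpeedLE u s q) : RightSpeedLE u t (Real.exp (κ * (t - s)) * q) := by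
  rw [rightSpeedLE_iff_nhdsGT_zero] at hq ⊢
  filter_upwards [hq, self_mem_nhdsWithin] with h hh hpos
  have hcontr := (hu.shift (mem_Ioi.1 hpos).le).dist_le hu hs hst
  rw [add_comm h t, mul_assoc]
  rw [add_comm h s] at hh
  exact hcontr.trans (mul_le_mul_of_nonneg_left hh (Real.exp_pos _).le)

lemma exists_lipschitzOnWith (hu : IsIntegralFlow E κ u) (ha : 0 < a) :
    ∃ C : ℝ≥0, LipschitzOnWith C u (Icc a b) := by
  obtain ⟨s, hs, q, hq⟩ := hu.acLoc.exists_rightSpeedLE (half_pos ha) (half_lt_self ha)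
  have hs0 : 0 ≤ s := (half_pos ha).le.trans hs.1.le
  refine ⟨(Real.exp (κ * (b - s)) * |q|).toNNReal,
    lipschitzOnWith_Icc_of_rightSpeedLE (hu.continuousOn_Icc ha.le) fun t ht => ?_⟩
  rw [Real.coe_toNNReal _ (by positivity)]
  filter_upwards [hu.rightSpeedLE_of_le hs0 (hs.2.le.trans ht.1) hq, self_mem_nhdsWithin]
    with r hr htr
  refine hr.trans (mul_le_mul_of_nonneg_right ?_ (sub_nonneg.2 (mem_Ioi.1 htr).le))
  calc Real.exp (κ * (t - s)) * q ≤ Real.exp (κ * (t - s)) * |q| := by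
        gcongr
        exact le_abs_self q
    _ ≤ Real.exp (κ * (b - s)) * |q| := by
        gcongr
        exacts [hu.nonneg, ht.2.le]

lemma energy_le_at (hE : Setting E) (hu : IsIntegralFlow E κ u) (ht : 0 ≤ t)
    (hq : RightSpeedLE u t q) {y : X} (hy : E y < ⊤) :
    E (u t) ≤ (((E y).toReal + q * dist (u t) y + κ / 2 * dist (u t) y ^ 2 : ℝ) : EReal) := by
  have hshift : RightSpeedLE (fun r => u (r + t)) 0 q := by
    simpa [rightSpeedLE_iff_nhdsGT_zero] using hq
  simpa using (hu.shift ht).energy_le_of_rightSpeedLE hE hshift hy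

lemma energy_lt_top (hE : Setting E) (hu : IsIntegralFlow E κ u) (ht : 0 < t) : E (u t) < ⊤ := by
  obtain ⟨C, hC⟩ := hu.exists_lipschitzOnWith (b := t + 1) ht
  obtain ⟨y, hy⟩ := hE.exists_lt_top (u 0)
  exact (hu.energy_le_at hE ht.le
    (rightSpeedLE_of_lipschitzOnWith hC ⟨le_rfl, lt_add_one t⟩) hy).trans_lt (EReal.coe_lt_top _)

lemma toReal_energy_le_at (hE : Setting E) (hu : IsIntegralFlow E κ u) (ht : 0 < t)
    (hq : RightSpeedLE u t q) {y : X} (hy : E y < ⊤) :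
    (E (u t)).toReal ≤ (E y).toReal + q * dist (u t) y + κ / 2 * dist (u t) y ^ 2 := by
  have h := hu.energy_le_at hE ht.le hq hy
  rwa [← hE.coe_toReal (hu.energy_lt_top hE ht), EReal.coe_le_coe_iff] at h

lemma metricSlope_le_of_rightSpeedLE (hE : Setting E) (hu : IsIntegralFlow E κ u) (ht : 0 < t)
    (hq0 : 0 ≤ q) (hq : RightSpeedLE u t q) : metricSlope E (u t) ≤ ENNReal.ofReal q :=
  metricSlope_le_of_energy_le hE.ne_bot (hu.energy_lt_top hE ht) hq0
    fun _ hy => hu.toReal_energy_le_at hE ht hq hy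

lemma exists_lipschitzOnWith_energy (hE : Setting E) (hu : IsIntegralFlow E κ u) (ha : 0 < a) :
    ∃ L : ℝ≥0, LipschitzOnWith L (fun t => (E (u t)).toReal) (Icc a b) := by
  obtain ⟨C, hC⟩ := hu.exists_lipschitzOnWith (b := b + 1) ha
  have hκ := hu.nonneg
  refine ⟨(C ^ 2 + κ / 2 * C ^ 2 * |b - a|).toNNReal,
    LipschitzOnWith.of_le_add_mul' _ fun s hs t ht => ?_⟩
  have hmem : ∀ r ∈ Icc a b, r ∈ Ico a (b + 1) := fun r hr => ⟨hr.1, by linarith [hr.2]⟩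
  have henergy := hu.toReal_energy_le_at hE (ha.trans_le hs.1)
    (rightSpeedLE_of_lipschitzOnWith hC (hmem s hs)) (hu.energy_lt_top hE (ha.trans_le ht.1))
  have hd : dist (u s) (u t) ≤ C * dist s t :=
    hC.dist_le_mul s (Ico_subset_Icc_self (hmem s hs)) t (Ico_subset_Icc_self (hmem t ht))
  have hst : dist s t ≤ |b - a| := (Real.dist_le_of_mem_Icc hs ht).trans (le_abs_self _)
  have hd2 : dist (u s) (u t) ^ 2 ≤ C ^ 2 * |b - a| * dist s t := by
    calc dist (u s) (u t) ^ 2 ≤ (C * dist s t) ^ 2 := by gcongr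
      _ = C ^ 2 * dist s t * dist s t := by ring
      _ ≤ C ^ 2 * |b - a| * dist s t := by gcongr
  linarith [mul_le_mul_of_nonneg_left hd C.coe_nonneg,
    mul_le_mul_of_nonneg_left hd2 (div_nonneg hκ zero_le_two)]

lemma absolutelyContinuousOnInterval_energy (hE : Setting E) (hu : IsIntegralFlow E κ u)
    (ha : 0 < a) (hab : a ≤ b) :
    AbsolutelyContinuousOnInterval (fun t => (E (u t)).toReal) a b := by
  obtain ⟨L, hL⟩ := hu.exists_lipschitzOnWith_energy hE (b := b) ha
  rw [← uIcc_of_le hab] at hL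
  exact hL.absolutelyContinuousOnInterval

lemma ae_differentiableAt_energy (hE : Setting E) (hu : IsIntegralFlow E κ u) :
    ∀ᵐ t : ℝ, 0 < t → DifferentiableAt ℝ (fun s => (E (u s)).toReal) t := by
  have h : ∀ n : ℕ, ∀ᵐ t : ℝ, t ∈ uIcc (1 / ((n : ℝ) + 1)) (n + 1) →
      DifferentiableAt ℝ (fun s => (E (u s)).toReal) t := fun n =>
    (hu.absolutelyContinuousOnInterval_energy hE Nat.one_div_pos_of_nat (by
      rw [div_le_iff₀ (by positivity)]
      nlinarith [Nat.cast_nonneg (α := ℝ) n])).ae_differentiableAt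
  filter_upwards [ae_all_iff.2 h] with t ht hpos
  obtain ⟨n, hn⟩ := exists_nat_one_div_lt hpos
  obtain ⟨m, hm⟩ := exists_nat_ge t
  refine ht (max n m) (mem_uIcc_of_le ?_ ?_)
  · refine le_trans ?_ hn.le
    gcongr
    exact le_max_left _ _
  · have : (m : ℝ) ≤ (max n m : ℕ) := by exact_mod_cast le_max_right _ _
    linarith

/-- The evolution variational inequality is tested at `u t` itself. -/
lemma eventually_dist_sq_le (hE : Setting E) (hu : IsIntegralFlow E κ u) {D ε : ℝ} (ht : 0 < t)
    (hD : HasDerivAt (fun s => (E (u s)).toReal) D t) (hε : 0 < ε) :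
    ∀ᶠ h in 𝓝[>] (0 : ℝ), dist (u (h + t)) (u t) ^ 2 ≤ (-D + ε) * h ^ 2 := by
  obtain ⟨C, hC⟩ := hu.exists_lipschitzOnWith (b := t + 1) ht
  have hslope : ∀ᶠ h in 𝓝[>] (0 : ℝ),
      (E (u t)).toReal + (D - ε / 2) * h ≤ (E (u (h + t))).toReal := by
    filter_upwards [hD.tendsto_slope_zero_right.eventually_const_lt
      (show D - ε / 2 < D by linarith), self_mem_nhdsWithin] with h hh hpos
    rw [smul_eq_mul, inv_mul_eq_div, lt_div_iff₀ hpos, add_comm t h] at hh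
    linarith
  obtain ⟨T, hT, hmin⟩ := exists_pos_forall_mem_Ioc hslope
  filter_upwards [eventually_mul_lt_nhdsGT_zero (κ * C ^ 2) (half_pos hε), Ioc_mem_nhdsGT hT,
    Ioc_mem_nhdsGT zero_lt_one] with h hsmall hhT hh1
  have hevi := (hu.shift ht.le).dist_sq_sub_le_of_minorant hE (hu.energy_lt_top hE ht) hhT.1
    (φ := fun r => (E (u t)).toReal + (D - ε / 2) * r)
    ((by fun_prop : Continuous fun r => (E (u t)).toReal + (D - ε / 2) * r).intervalIntegrable _ _)
    fun r hr => by
      rw [← hE.coe_toReal (hu.energy_lt_top hE (add_pos hr.1 ht)), EReal.coe_le_coe_iff]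
      exact hmin r ⟨hr.1, hr.2.trans hhT.2⟩
  have hquad := (hu.shift ht.le).integral_dist_sq_le le_rfl hhT.1.le (y := u t)
    (M := (C * h) ^ 2) fun r hr => by
      have hlip := hC.dist_le_mul (r + t) ⟨by linarith [hr.1], by linarith [hr.2, hh1.2]⟩ t
        ⟨le_rfl, by linarith⟩
      rw [Real.dist_eq, add_sub_cancel_right, abs_of_nonneg hr.1] at hlip
      exact pow_le_pow_left₀ dist_nonneg
        (hlip.trans (mul_le_mul_of_nonneg_left hr.2 C.coe_nonneg)) 2
  rw [intervalIntegral.integral_add intervalIntegrable_const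
    ((continuous_const_mul _).intervalIntegrable _ _), intervalIntegral.integral_const_mul,
    intervalIntegral.integral_const, integral_id] at hevi
  simp only [zero_add, dist_self, smul_eq_mul] at hevi
  nlinarith [mul_le_mul_of_nonneg_right hsmall.le (sq_nonneg h)]

lemma deriv_energy_nonpos (hE : Setting E) (hu : IsIntegralFlow E κ u) {D : ℝ} (ht : 0 < t)
    (hD : HasDerivAt (fun s => (E (u s)).toReal) D t) : D ≤ 0 := by
  by_contra! hpos
  obtain ⟨h, hh, hh0 : 0 < h⟩ := ((hu.eventually_dist_sq_le hE ht hD (half_pos hpos)).and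
    self_mem_nhdsWithin).exists
  nlinarith [sq_nonneg (dist (u (h + t)) (u t)), pow_pos hh0 2]

lemma rightSpeedLE_of_sqrt_lt (hE : Setting E) (hu : IsIntegralFlow E κ u) {D : ℝ} (ht : 0 < t)
    (hD : HasDerivAt (fun s => (E (u s)).toReal) D t) (hq : √(-D) < q) : RightSpeedLE u t q := by
  have hq0 : 0 < q := (Real.sqrt_nonneg _).trans_lt hq
  have hlt : -D < q ^ 2 := (Real.sqrt_lt' hq0).1 hq
  rw [rightSpeedLE_iff_nhdsGT_zero]
  filter_upwards [hu.eventually_dist_sq_le hE ht hD (sub_pos.2 hlt), self_mem_nhdsWithin]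
    with h hh hpos
  refine le_of_sq_le_sq (hh.trans_eq (by ring)) (mul_nonneg hq0.le (mem_Ioi.1 hpos).le)

lemma metricSlope_le_exp_mul_sqrt (hE : Setting E) (hu : IsIntegralFlow E κ u) {D : ℝ} (hs : 0 < s)
    (hst : s ≤ t) (hD : HasDerivAt (fun s => (E (u s)).toReal) D s) :
    metricSlope E (u t) ≤ ENNReal.ofReal (Real.exp (κ * (t - s)) * √(-D)) := by
  have hlim : Tendsto (fun q => ENNReal.ofReal (Real.exp (κ * (t - s)) * q)) (𝓝[>] √(-D))
      (𝓝 (ENNReal.ofReal (Real.exp (κ * (t - s)) * √(-D)))) :=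
    (ENNReal.continuous_ofReal.comp (continuous_const_mul _)).continuousWithinAt
  refine ge_of_tendsto hlim (eventually_mem_nhdsWithin.mono fun q hq => ?_)
  have hq0 : 0 ≤ q := (Real.sqrt_nonneg _).trans (mem_Ioi.1 hq).le
  exact hu.metricSlope_le_of_rightSpeedLE hE (hs.trans_le hst) (by positivity)
    (hu.rightSpeedLE_of_le hs.le hst (hu.rightSpeedLE_of_sqrt_lt hE hs hD hq))

lemma antitoneOn_energy (hE : Setting E) (hu : IsIntegralFlow E κ u) :
    AntitoneOn (fun t => (E (u t)).toReal) (Ioi 0) := by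
  intro a ha b _ hab
  have hftc := (hu.absolutelyContinuousOnInterval_energy hE ha hab).integral_deriv_eq_sub
  have hnonpos : ∫ t in a..b, deriv (fun s => (E (u s)).toReal) t ≤ 0 := by
    rw [intervalIntegral.integral_of_le hab]
    refine integral_nonpos_of_ae ?_
    filter_upwards [ae_restrict_of_ae (hu.ae_differentiableAt_energy hE),
      ae_restrict_mem measurableSet_Ioc] with t hd ht
    have htpos : 0 < t := (mem_Ioi.1 ha).trans ht.1
    exact hu.deriv_energy_nonpos hE htpos (hd htpos).hasDerivAt
  linarith

lemma lintegral_neg_deriv_energy (hE : Setting E) (hu : IsIntegralFlow E κ u) (ha : 0 < a)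
    (hab : a ≤ b) :
    ∫⁻ t in Ioc a b, ENNReal.ofReal (-deriv (fun s => (E (u s)).toReal) t) =
      ENNReal.ofReal ((E (u a)).toReal - (E (u b)).toReal) := by
  have hac := hu.absolutelyContinuousOnInterval_energy hE ha hab
  have hftc := hac.integral_deriv_eq_sub
  rw [intervalIntegral.integral_of_le hab] at hftc
  rw [← neg_sub, ← hftc, ← integral_neg]
  refine (ofReal_integral_eq_lintegral_ofReal
    ((intervalIntegrable_iff_integrableOn_Ioc_of_le hab).1 hac.intervalIntegrable_deriv).neg
    ?_).symm
  filter_upwards [ae_restrict_of_ae (hu.ae_differentiableAt_energy hE),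
    ae_restrict_mem measurableSet_Ioc] with t hd ht
  exact neg_nonneg.2 (hu.deriv_energy_nonpos hE (ha.trans ht.1) (hd (ha.trans ht.1)).hasDerivAt)

lemma mul_energy_sub_le (hE : Setting E) (hu : IsIntegralFlow E κ u) {y : X} {M : ℝ} (hy : E y < ⊤)
    (ht : 0 < t) (hM : ∀ r ∈ Icc 0 t, dist (u r) y ^ 2 ≤ M) :
    2 * t * ((E (u t)).toReal - (E y).toReal) ≤ dist (u 0) y ^ 2 + κ * (t * M) := by
  have h := hu.dist_sq_sub_le_of_bounds hE hy ht (c := (E (u t)).toReal) (fun r hr => by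
    rw [← hE.coe_toReal (hu.energy_lt_top hE hr.1), EReal.coe_le_coe_iff]
    exact hu.antitoneOn_energy hE hr.1 ht hr.2) hM
  linarith [sq_nonneg (dist (u t) y)]

end IsIntegralFlow

end FlowRegularity

/-! ### Curves of finite action -/

section IntervalLIntegral

lemma lintegral_Ioc_add_lintegral_Ioc {a b c : ℝ} (hab : a ≤ b) (hbc : b ≤ c) (f : ℝ → ℝ≥0∞) :
    (∫⁻ t in Ioc a b, f t) + ∫⁻ t in Ioc b c, f t = ∫⁻ t in Ioc a c, f t := by
  rw [← Ioc_union_Ioc_eq_Ioc hab hbc,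
    lintegral_union measurableSet_Ioc (Ioc_disjoint_Ioc_of_le le_rfl)]

lemma lintegral_comp_mul_add {c : ℝ} (hc : 0 < c) (d s t : ℝ) (f : ℝ → ℝ≥0∞) :
    ENNReal.ofReal c * ∫⁻ r in Ioc s t, f (c * r + d) =
      ∫⁻ r in Ioc (c * s + d) (c * t + d), f r := by
  rw [← image_affine_Ioc hc, lintegral_image_eq_lintegral_abs_deriv_mul measurableSet_Ioc
    (f := fun r => c * r + d) (f' := fun _ => c)
    (fun r _ => by simpa using (((hasDerivAt_id r).const_mul c).add_const d).hasDerivWithinAt)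
    (fun p _ q _ hpq => by simpa [hc.ne'] using hpq), abs_of_pos hc,
    lintegral_const_mul' _ _ ENNReal.ofReal_ne_top]

lemma lintegral_comp_sub_left (d s t : ℝ) (f : ℝ → ℝ≥0∞) :
    ∫⁻ r in Ioc s t, f (d - r) = ∫⁻ r in Ioc (d - t) (d - s), f r := by
  rw [(Measure.measurePreserving_sub_left volume d).setLIntegral_comp_emb
    (MeasurableEquiv.subLeft d).measurableEmbedding, image_const_sub_Ioc,
    setLIntegral_congr Ico_ae_eq_Ioc]

lemma lintegral_comp_neg (s t : ℝ) (f : ℝ → ℝ≥0∞) :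
    ∫⁻ r in Ioc s t, f (-r) = ∫⁻ r in Ioc (-t) (-s), f r := by
  simpa only [zero_sub] using lintegral_comp_sub_left 0 s t f

lemma ae_comp_mul_add {c : ℝ} (hc : c ≠ 0) (d : ℝ) {p : ℝ → Prop} (h : ∀ᵐ t, p t) :
    ∀ᵐ t : ℝ, p (c * t + d) := by
  have hmul : Measure.QuasiMeasurePreserving (fun t : ℝ => c * t) volume volume := by
    refine ⟨measurable_const_mul c, ?_⟩
    rw [Real.map_volume_mul_left hc]
    exact Measure.smul_absolutelyContinuous
  exact ((measurePreserving_add_right volume d).quasiMeasurePreserving.comp hmul).ae h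

lemma lintegral_Ioc_le_of_forall_lt {f : ℝ → ℝ≥0∞} {a b : ℝ} {C : ℝ≥0∞} (hf : Measurable f)
    (h : ∀ s ∈ Ioi a, ∫⁻ t in Ioc s b, f t ≤ C) : ∫⁻ t in Ioc a b, f t ≤ C := by
  have hcover : AECover (volume.restrict (Ioc a b)) (𝓝[>] a) (fun s => Ioc s b) :=
    aecover_Ioc_of_Ioc (tendsto_id.mono_left nhdsWithin_le_nhds) tendsto_const_nhds
  refine le_of_tendsto (hcover.lintegral_tendsto_of_countably_generated hf.aemeasurable)
    (eventually_mem_nhdsWithin.mono fun s hs => ?_)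
  rw [Measure.restrict_restrict measurableSet_Ioc]
  exact (lintegral_mono_set inter_subset_left).trans (h s hs)

end IntervalLIntegral

section ActionBound

variable {X : Type*} [MetricSpace X] {E : X → EReal} {γ η : ℝ → X} {g k : ℝ → ℝ≥0∞} {a b c : ℝ}

/-- The function `g ∈ L²(a, b)` dominates the speed of `γ`: the increments of `γ` on `[a, b]` are
bounded by the integrals of `g`. -/
structure IsSquareSpeedBound (γ : ℝ → X) (g : ℝ → ℝ≥0∞) (a b : ℝ) : Prop where
  measurable : Measurable g
  lintegral_sq_lt_top : ∫⁻ t in Ioc a b, g t ^ 2 < ⊤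
  edist_le : ∀ s t : ℝ, a ≤ s → s ≤ t → t ≤ b → edist (γ s) (γ t) ≤ ∫⁻ r in Ioc s t, g r

/-- The square integrable function `g` dominates both the speed of `γ` on `[a, b]` and the slope
of `E` along `γ`, so that the action of `γ` is finite. -/
structure IsActionBound (E : X → EReal) (γ : ℝ → X) (g : ℝ → ℝ≥0∞) (a b : ℝ) : Prop
    extends IsSquareSpeedBound γ g a b where
  metricSlope_le : ∀ᵐ t, t ∈ Ioo a b → metricSlope E (γ t) ≤ g t

namespace IsSquareSpeedBound

lemma lintegral_lt_top (h : IsSquareSpeedBound γ g a b) : ∫⁻ t in Ioc a b, g t < ⊤ := by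
  refine (ENNReal.pow_lt_top_iff.1 ((sq_setLIntegral_Ioc_le g a b).trans_lt ?_)).resolve_right
    two_ne_zero
  exact ENNReal.mul_lt_top ENNReal.ofReal_lt_top h.lintegral_sq_lt_top

lemma ae_lt_top (h : IsSquareSpeedBound γ g a b) : ∀ᵐ t ∂volume.restrict (Ioc a b), g t < ⊤ :=
  MeasureTheory.ae_lt_top h.measurable h.lintegral_lt_top.ne

lemma isSpeedBound (h : IsSquareSpeedBound γ g a b) :
    IsSpeedBound γ (fun t => (g t).toReal) a b := by
  refine ⟨?_, fun s t hs hst ht => ?_⟩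
  · rw [integrableOn_Icc_iff_integrableOn_Ioc]
    exact integrable_toReal_of_lintegral_ne_top h.measurable.aemeasurable h.lintegral_lt_top.ne
  · have hsub : Ioc s t ⊆ Ioc a b := Ioc_subset_Ioc hs ht
    rw [intervalIntegral.integral_of_le hst, integral_toReal h.measurable.aemeasurable
      (ae_restrict_of_ae_restrict_of_subset hsub h.ae_lt_top), dist_edist]
    exact ENNReal.toReal_mono ((lintegral_mono_set hsub).trans_lt h.lintegral_lt_top).ne
      (h.edist_le s t hs hst ht)

lemma acOn (h : IsSquareSpeedBound γ g a b) : ACOn γ a b := ⟨_, h.isSpeedBound⟩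

lemma metricSpeed_le (h : IsSquareSpeedBound γ g a b) (hab : a ≤ b) :
    ∀ᵐ t ∂volume.restrict (Icc a b), metricSpeed γ t ≤ g t := by
  have hlt := h.ae_lt_top
  have hspeed := (ae_restrict_iff' measurableSet_Ioo).2 (h.isSpeedBound.metricSpeed_le hab)
  rw [restrict_Ioo_eq_restrict_Icc] at hspeed
  rw [restrict_Ioc_eq_restrict_Icc] at hlt
  filter_upwards [hspeed, hlt] with t ht hlt
  rwa [abs_of_nonneg ENNReal.toReal_nonneg, ENNReal.ofReal_toReal hlt.ne] at ht

end IsSquareSpeedBound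

namespace IsActionBound

lemma comp_mul_add {d : ℝ} (h : IsActionBound E γ g (c * a + d) (c * b + d)) (hc : 0 < c) :
    IsActionBound E (fun t => γ (c * t + d)) (fun t => ENNReal.ofReal (max 1 c) * g (c * t + d))
      a b where
  measurable := measurable_const.mul (h.measurable.comp (by fun_prop))
  lintegral_sq_lt_top := by
    have hfin := h.lintegral_sq_lt_top
    rw [← lintegral_comp_mul_add hc] at hfin
    simp only [mul_pow]
    rw [lintegral_const_mul' _ _ (by finiteness)]
    exact ENNReal.mul_lt_top (by finiteness)
      (ENNReal.lt_top_of_mul_ne_top_right hfin.ne (ENNReal.ofReal_pos.2 hc).ne')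
  edist_le s t hs hst ht := by
    calc edist (γ (c * s + d)) (γ (c * t + d))
        ≤ ∫⁻ r in Ioc (c * s + d) (c * t + d), g r :=
          h.edist_le _ _ (by gcongr) (by gcongr) (by gcongr)
      _ = ENNReal.ofReal c * ∫⁻ r in Ioc s t, g (c * r + d) :=
          (lintegral_comp_mul_add hc d s t g).symm
      _ ≤ ENNReal.ofReal (max 1 c) * ∫⁻ r in Ioc s t, g (c * r + d) := by
          gcongr
          exact le_max_right _ _
      _ = _ := (lintegral_const_mul' _ _ ENNReal.ofReal_ne_top).symm
  metricSlope_le := by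
    filter_upwards [ae_comp_mul_add hc.ne' d h.metricSlope_le] with t ht hmem
    refine (ht ⟨by gcongr; exact hmem.1, by gcongr; exact hmem.2⟩).trans (le_mul_of_one_le_left' ?_)
    exact ENNReal.one_le_ofReal.2 (le_max_left _ _)

lemma comp_neg (h : IsActionBound E γ g a b) :
    IsActionBound E (fun t => γ (-t)) (fun t => g (-t)) (-b) (-a) where
  measurable := h.measurable.comp measurable_neg
  lintegral_sq_lt_top := by
    rw [lintegral_comp_neg _ _ fun t => g t ^ 2, neg_neg, neg_neg]
    exact h.lintegral_sq_lt_top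
  edist_le s t hs hst ht := by
    rw [lintegral_comp_neg, edist_comm]
    exact h.edist_le _ _ (by linarith) (by linarith) (by linarith)
  metricSlope_le := by
    filter_upwards [ae_comp_mul_add (neg_ne_zero.2 one_ne_zero) 0 h.metricSlope_le] with t ht hmem
    rw [neg_one_mul, add_zero] at ht
    exact ht ⟨by linarith [hmem.2], by linarith [hmem.1]⟩

lemma congr (h : IsActionBound E γ g a b) (hk : Measurable k) (hγη : EqOn η γ (Icc a b))
    (hkg : EqOn k g (Ioc a b)) : IsActionBound E η k a b where
  measurable := hk
  lintegral_sq_lt_top := by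
    rw [setLIntegral_congr_fun measurableSet_Ioc fun t ht => by rw [hkg ht]]
    exact h.lintegral_sq_lt_top
  edist_le s t hs hst ht := by
    rw [hγη ⟨hs, hst.trans ht⟩, hγη ⟨hs.trans hst, ht⟩,
      setLIntegral_congr_fun measurableSet_Ioc fun r hr => hkg ⟨hs.trans_lt hr.1, hr.2.trans ht⟩]
    exact h.edist_le s t hs hst ht
  metricSlope_le := by
    filter_upwards [h.metricSlope_le] with t ht hmem
    rw [hγη (Ioo_subset_Icc_self hmem), hkg (Ioo_subset_Ioc_self hmem)]
    exact ht hmem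

lemma union (h : IsActionBound E γ g a b) (h' : IsActionBound E γ g b c) (hab : a ≤ b)
    (hbc : b ≤ c) : IsActionBound E γ g a c where
  measurable := h.measurable
  lintegral_sq_lt_top := by
    rw [← lintegral_Ioc_add_lintegral_Ioc hab hbc]
    exact ENNReal.add_lt_top.2 ⟨h.lintegral_sq_lt_top, h'.lintegral_sq_lt_top⟩
  edist_le s t hs hst ht := by
    rcases le_total t b with htb | hbt
    · exact h.edist_le s t hs hst htb
    rcases le_total b s with hbs | hsb
    · exact h'.edist_le s t hbs hst ht
    rw [← lintegral_Ioc_add_lintegral_Ioc hsb hbt]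
    exact (edist_triangle _ (γ b) _).trans
      (add_le_add (h.edist_le s b hs hsb le_rfl) (h'.edist_le b t le_rfl hbt ht))
  metricSlope_le := by
    filter_upwards [h.metricSlope_le, h'.metricSlope_le, Measure.ae_ne volume b]
      with t ht ht' hne hmem
    rcases lt_or_gt_of_ne hne with hlt | hgt
    · exact ht ⟨hmem.1, hlt⟩
    · exact ht' ⟨hgt, hmem.2⟩

lemma glue (h : IsActionBound E γ g a b) (h' : IsActionBound E η k b c) (hab : a ≤ b)
    (hbc : b ≤ c) (hb : γ b = η b) :
    IsActionBound E (fun t => if t ≤ b then γ t else η t) (fun t => if t ≤ b then g t else k t)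
      a c := by
  have hmeas : Measurable fun t => if t ≤ b then g t else k t :=
    Measurable.ite measurableSet_Iic h.measurable h'.measurable
  refine (h.congr hmeas (fun t ht => if_pos ht.2) fun t ht => if_pos ht.2).union
    (h'.congr hmeas (fun t ht => ?_) fun t ht => if_neg (not_le.2 ht.1)) hab hbc
  rcases ht.1.eq_or_lt with rfl | hlt
  · simp [hb]
  · exact if_neg (not_le.2 hlt)

lemma schrodingerAction_lt_top (h : IsActionBound E γ g 0 1) (ε : ℝ) :
    schrodingerAction E ε γ < ⊤ := by
  have hfin : ∀ {p : ℝ → ℝ≥0∞}, (∀ᵐ t ∂volume.restrict (Icc (0 : ℝ) 1), p t ≤ g t) →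
      ∫⁻ t in Icc (0 : ℝ) 1, p t ^ 2 < ⊤ := fun {p} hp => by
    refine lt_of_le_of_lt (lintegral_mono_ae (hp.mono fun t ht => pow_le_pow_left' ht 2)) ?_
    rw [← restrict_Ioc_eq_restrict_Icc]
    exact h.lintegral_sq_lt_top
  have hslope := (ae_restrict_iff' measurableSet_Ioo).2 h.metricSlope_le
  rw [restrict_Ioo_eq_restrict_Icc] at hslope
  rw [schrodingerAction, kineticEnergy, if_pos h.acOn, fisherInformation]
  exact ENNReal.add_lt_top.2 ⟨ENNReal.mul_lt_top (by simp) (hfin (h.metricSpeed_le zero_le_one)),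
    ENNReal.mul_lt_top ENNReal.ofReal_lt_top (ENNReal.mul_lt_top (by simp) (hfin hslope))⟩

end IsActionBound

/-- `x` and `y` are the endpoints of a curve of finite action, over some bounded time interval. -/
def FiniteActionJoined (E : X → EReal) (x y : X) : Prop :=
  ∃ (γ : ℝ → X) (g : ℝ → ℝ≥0∞) (a b : ℝ), a < b ∧ IsActionBound E γ g a b ∧ γ a = x ∧ γ b = y

namespace FiniteActionJoined

variable {x y z : X}

lemma symm (h : FiniteActionJoined E x y) : FiniteActionJoined E y x := by
  obtain ⟨γ, g, a, b, hab, hγ, hx, hy⟩ := h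
  exact ⟨_, _, -b, -a, neg_lt_neg hab, hγ.comp_neg, by simpa using hy, by simpa using hx⟩

lemma trans (h : FiniteActionJoined E x y) (h' : FiniteActionJoined E y z) :
    FiniteActionJoined E x z := by
  obtain ⟨γ, g, a, b, hab, hγ, rfl, rfl⟩ := h
  obtain ⟨η, k, c, d, hcd, hη, hc, rfl⟩ := h'
  have hη' : IsActionBound E (fun t => η (1 * t + (c - b)))
      (fun t => ENNReal.ofReal (max 1 1) * k (1 * t + (c - b))) b (b + (d - c)) := by
    refine IsActionBound.comp_mul_add ?_ one_pos
    convert! hη using 1 <;> ring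
  refine ⟨_, _, a, b + (d - c), by linarith, hγ.glue hη' hab.le (by linarith) ?_, if_pos hab.le,
    (if_neg (by linarith)).trans ?_⟩
  · simp [hc]
  · ring_nf

lemma exists_schrodingerAction_lt_top (h : FiniteActionJoined E x y) (ε : ℝ) :
    ∃ γ ∈ curvesJoining x y, schrodingerAction E ε γ < ⊤ := by
  obtain ⟨γ, g, a, b, hab, hγ, rfl, rfl⟩ := h
  have hγ' : IsActionBound E (fun t => γ ((b - a) * t + a)) _ 0 1 :=
    IsActionBound.comp_mul_add (g := g) (by simpa using hγ) (sub_pos.2 hab)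
  exact ⟨_, ⟨hγ'.acOn.continuousOn zero_le_one, by simp, by simp⟩,
    hγ'.schrodingerAction_lt_top ε⟩

end FiniteActionJoined

end ActionBound

section FlowAction

/-- The square root of the rate at which `E` decreases along `u`. It bounds both the speed and the
slope of a gradient flow. -/
def dissipation {X : Type*} (E : X → EReal) (u : ℝ → X) (t : ℝ) : ℝ≥0∞ :=
  ENNReal.ofReal √(-deriv (fun s => (E (u s)).toReal) t)

lemma measurable_dissipation {X : Type*} (E : X → EReal) (u : ℝ → X) :
    Measurable (dissipation E u) :=
  (measurable_deriv _).neg.sqrt.ennreal_ofReal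

variable {X : Type*} [MetricSpace X] {E : X → EReal} {κ a b : ℝ} {u : ℝ → X}

namespace IsIntegralFlow

lemma lintegral_dissipation_sq (hE : Setting E) (hu : IsIntegralFlow E κ u) (ha : 0 < a)
    (hab : a ≤ b) :
    ∫⁻ t in Ioc a b, dissipation E u t ^ 2 =
      ENNReal.ofReal ((E (u a)).toReal - (E (u b)).toReal) := by
  rw [← hu.lintegral_neg_deriv_energy hE ha hab]
  refine setLIntegral_congr_fun_ae measurableSet_Ioc ?_
  filter_upwards [hu.ae_differentiableAt_energy hE] with t hd ht
  have htpos : 0 < t := ha.trans ht.1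
  rw [dissipation, ← ENNReal.ofReal_pow (Real.sqrt_nonneg _), Real.sq_sqrt
    (neg_nonneg.2 (hu.deriv_energy_nonpos hE htpos (hd htpos).hasDerivAt))]

lemma lintegral_dissipation_sq_lt_top (hE : Setting E) (hu : IsIntegralFlow E κ u)
    (h0 : E (u 0) < ⊤) (b : ℝ) : ∫⁻ t in Ioc 0 b, dissipation E u t ^ 2 < ⊤ := by
  obtain ⟨c, hc⟩ := hE.exists_lower_bound (hu.continuousOn_Icc le_rfl (b := b))
  obtain ⟨M, hM⟩ := (isCompact_Icc.image_of_continuousOn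
    ((continuousOn_dist_const (hu.continuousOn_Icc le_rfl (b := b)) (u 0)).pow 2)).bddAbove
  refine (lintegral_Ioc_le_of_forall_lt (C := ENNReal.ofReal ((E (u 0)).toReal + κ * M / 2 - c))
    ((measurable_dissipation E u).pow_const 2) fun s hs => ?_).trans_lt ENNReal.ofReal_lt_top
  rcases le_or_gt b s with hbs | hsb
  · simp [Ioc_eq_empty (not_lt.2 hbs)]
  have hs : 0 < s := hs
  rw [hu.lintegral_dissipation_sq hE hs hsb.le]
  refine ENNReal.ofReal_le_ofReal (sub_le_sub ?_ (hE.le_toReal (hu.energy_lt_top hE (hs.trans hsb))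
    (hc b ⟨(hs.trans hsb).le, le_rfl⟩)))
  have hup := hu.mul_energy_sub_le hE h0 hs fun r hr =>
    hM (mem_image_of_mem _ ⟨hr.1, hr.2.trans hsb.le⟩)
  rw [dist_self] at hup
  nlinarith

lemma edist_le_lintegral_dissipation (hE : Setting E) (hu : IsIntegralFlow E κ u) (ha : 0 ≤ a)
    (hab : a ≤ b) : edist (u a) (u b) ≤ ∫⁻ t in Ioc a b, dissipation E u t := by
  have hpos : ∀ s ∈ Ioc a b, edist (u s) (u b) ≤ ∫⁻ t in Ioc a b, dissipation E u t := by
    intro s hs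
    have hs0 : 0 < s := ha.trans_lt hs.1
    obtain ⟨C, hC⟩ := hu.exists_lipschitzOnWith (b := b) hs0
    rw [← uIcc_of_le hs.2] at hC
    refine (edist_le_lintegral_of_rightSpeedLE hs.2 hC.absolutelyContinuousOnInterval ?_).trans
      (lintegral_mono_set (Ioc_subset_Ioc_left hs.1.le))
    filter_upwards [hu.ae_differentiableAt_energy hE] with t hd ht q hq
    have ht0 : 0 < t := hs0.trans ht.1
    exact hu.rightSpeedLE_of_sqrt_lt hE ht0 (hd ht0).hasDerivAt
      ((ENNReal.ofReal_lt_ofReal_iff_of_nonneg (Real.sqrt_nonneg _)).1 hq)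
  rcases hab.eq_or_lt with rfl | hab
  · simp
  have hlim : Tendsto u (𝓝[>] a) (𝓝 (u a)) :=
    (hu.continuousOn a ha).mono_left (nhdsWithin_mono _ fun t ht => ha.trans (mem_Ioi.1 ht).le)
  exact le_of_tendsto (hlim.edist tendsto_const_nhds)
    (mem_of_superset (Ioc_mem_nhdsGT hab) hpos)

lemma isActionBound (hE : Setting E) (hu : IsIntegralFlow E κ u) (h0 : E (u 0) < ⊤) (b : ℝ) :
    IsActionBound E u (dissipation E u) 0 b where
  measurable := measurable_dissipation E u
  lintegral_sq_lt_top := hu.lintegral_dissipation_sq_lt_top hE h0 b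
  edist_le _ _ hs hst _ := hu.edist_le_lintegral_dissipation hE hs hst
  metricSlope_le := by
    filter_upwards [hu.ae_differentiableAt_energy hE] with t hd ht
    simpa [dissipation] using hu.metricSlope_le_exp_mul_sqrt hE ht.1 le_rfl (hd ht.1).hasDerivAt

lemma exists_dissipation_sq_le (hE : Setting E) (hu : IsIntegralFlow E κ u) (ha : 0 < a)
    (hab : a < b) :
    ∃ t ∈ Ioc a b, DifferentiableAt ℝ (fun s => (E (u s)).toReal) t ∧
      dissipation E u t ^ 2 ≤
        ENNReal.ofReal (((E (u a)).toReal - (E (u b)).toReal) / (b - a)) := by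
  have hvol : volume.restrict (Ioc a b) ≠ 0 := by
    simpa [Measure.restrict_eq_zero] using hab
  obtain ⟨t, ht, hle⟩ := exists_notMem_null_le_laverage hvol
    ((measurable_dissipation E u).pow_const 2).aemeasurable
    (show volume.restrict (Ioc a b) {t | ¬(t ∈ Ioc a b ∧
      DifferentiableAt ℝ (fun s => (E (u s)).toReal) t)} = 0 by
        rw [← ae_iff]
        filter_upwards [ae_restrict_mem measurableSet_Ioc,
          ae_restrict_of_ae (hu.ae_differentiableAt_energy hE)] with t ht hd
        exact ⟨ht, hd (ha.trans ht.1)⟩)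
  rw [mem_ofPred_eq, not_not] at ht
  rw [setLAverage_eq, hu.lintegral_dissipation_sq hE ha hab.le, Real.volume_Ioc,
    ← ENNReal.ofReal_div_of_pos (sub_pos.2 hab)] at hle
  exact ⟨t, ht.1, ht.2, hle⟩

lemma metricSlope_le_exp_mul_sqrt_energy (hE : Setting E) (hu : IsIntegralFlow E κ u)
    (ha : 0 < a) (hab : a < b) :
    metricSlope E (u b) ≤ ENNReal.ofReal (Real.exp (κ * (b - a)) *
      √(((E (u a)).toReal - (E (u b)).toReal) / (b - a))) := by
  have hκ := hu.nonneg
  obtain ⟨t, ht, hd, hle⟩ := hu.exists_dissipation_sq_le hE ha hab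
  refine (hu.metricSlope_le_exp_mul_sqrt hE (ha.trans ht.1) ht.2 hd.hasDerivAt).trans
    (ENNReal.ofReal_le_ofReal ?_)
  have hsqrt : √(-deriv (fun s => (E (u s)).toReal) t) ≤
      √(((E (u a)).toReal - (E (u b)).toReal) / (b - a)) := by
    refine Real.le_sqrt_of_sq_le ((ENNReal.ofReal_le_ofReal_iff ?_).1 ?_)
    · exact div_nonneg (sub_nonneg.2 (hu.antitoneOn_energy hE ha (ha.trans hab) hab.le))
        (sub_pos.2 hab).le
    · rwa [ENNReal.ofReal_pow (Real.sqrt_nonneg _)]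
  gcongr
  exact ht.1.le

lemma exists_dist_le (hu : IsIntegralFlow E κ u) (R T : ℝ) :
    ∃ M, ∀ w, IsIntegralFlow E κ w → dist (w 0) (u 0) ≤ R →
      ∀ t ∈ Icc 0 T, dist (w t) (u 0) ≤ M := by
  have hκ := hu.nonneg
  obtain ⟨D, hD⟩ := (isCompact_Icc.image_of_continuousOn
    (continuousOn_dist_const (hu.continuousOn_Icc le_rfl (b := T)) (u 0))).bddAbove
  refine ⟨Real.exp (κ * T) * R + D, fun w hw hR t ht => ?_⟩
  have hcontr : dist (w t) (u t) ≤ Real.exp (κ * T) * R := by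
    refine (hw.dist_le hu le_rfl ht.1).trans ?_
    rw [sub_zero]
    gcongr
    exact ht.2
  exact (dist_triangle _ (u t) _).trans
    (add_le_add hcontr (hD (mem_image_of_mem _ ht)))

lemma exists_metricSlope_le (hE : Setting E) (hu : IsIntegralFlow E κ u)
    (h0 : E (u 0) < ⊤) (R : ℝ) :
    ∃ S : ℝ, ∀ w, IsIntegralFlow E κ w → dist (w 0) (u 0) ≤ R →
      metricSlope E (w 1) ≤ ENNReal.ofReal S := by
  have := hu.nonneg
  obtain ⟨M, hM⟩ := hu.exists_dist_le R 1
  obtain ⟨c, hc⟩ := hE.bounded_below (Metric.closedBall (u 0) M) Metric.isBounded_closedBall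
  refine ⟨Real.exp (κ * (1 - 1 / 2)) *
    √(((E (u 0)).toReal + R ^ 2 + κ * (1 / 2 * M ^ 2) - c) / (1 - 1 / 2)), fun w hw hR => ?_⟩
  refine (hw.metricSlope_le_exp_mul_sqrt_energy hE one_half_pos one_half_lt_one).trans ?_
  have hup := hw.mul_energy_sub_le hE h0 one_half_pos fun r hr =>
    pow_le_pow_left₀ dist_nonneg (hM w hw hR r ⟨hr.1, hr.2.trans one_half_lt_one.le⟩) 2
  have hR2 : dist (w 0) (u 0) ^ 2 ≤ R ^ 2 := pow_le_pow_left₀ dist_nonneg hR 2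
  gcongr ENNReal.ofReal (_ * √((?_ - ?_) / _))
  · linarith
  · exact hE.le_toReal (hw.energy_lt_top hE one_pos)
      (hc _ (Metric.mem_closedBall.2 (hM w hw hR 1 ⟨zero_le_one, le_rfl⟩)))

end IsIntegralFlow

end FlowAction

section Competitor

variable {X : Type*} [MetricSpace X] {E : X → EReal} {γ : ℝ → X} {a b : ℝ}

lemma ACOn.exists_isSpeedBound_nonneg (h : ACOn γ a b) :
    ∃ m, 0 ≤ m ∧ IsSpeedBound γ m a b := by
  obtain ⟨m, hm⟩ : ∃ m, IsSpeedBound γ m a b := h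
  refine ⟨fun t => |m t|, fun t => abs_nonneg _, hm.1.abs, fun s t hs hst ht => ?_⟩
  have hint := (hm.mono hs ht).intervalIntegrable hst
  exact (hm.2 s t hs hst ht).trans
    (intervalIntegral.integral_mono_on hst hint hint.abs fun r _ => le_abs_self _)

lemma ACOn.exists_lipschitzOnWith_reparametrization (h : ACOn γ 0 1) :
    ∃ (η : ℝ → X) (ℓ : ℝ≥0), η 0 = γ 0 ∧ η 1 = γ 1 ∧ LipschitzOnWith ℓ η (Icc 0 1) := by
  obtain ⟨m, hm0, hm⟩ := h.exists_isSpeedBound_nonneg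
  set L : ℝ → ℝ := fun t => ∫ r in (0 : ℝ)..t, m r
  have hL0 : L 0 = 0 := intervalIntegral.integral_same
  have hL1 : 0 ≤ L 1 := intervalIntegral.integral_nonneg zero_le_one fun r _ => hm0 r
  have hdist : ∀ s ∈ Icc (0 : ℝ) 1, ∀ t ∈ Icc (0 : ℝ) 1, dist (γ s) (γ t) ≤ |L t - L s| :=
    fun s hs t ht => hm.dist_le_abs_integral hs ht
  have harc : ∀ s ∈ Icc (0 : ℝ) 1, ∃ τ ∈ Icc (0 : ℝ) 1, L τ = L 1 * s := fun s hs => by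
    have hivt := intermediate_value_Icc zero_le_one
      (continuousOn_primitive_Icc zero_le_one (hm.intervalIntegrable zero_le_one))
    rw [intervalIntegral.integral_same] at hivt
    exact hivt ⟨mul_nonneg hL1 hs.1, mul_le_of_le_one_right hL1 hs.2⟩
  choose! τ hτ hLτ using harc
  have hendpoint : ∀ s ∈ Icc (0 : ℝ) 1, L s = L 1 * s → γ (τ s) = γ s := fun s hs hLs =>
    dist_le_zero.1 ((hdist _ (hτ s hs) s hs).trans (by simp [hLτ s hs, hLs]))
  refine ⟨γ ∘ τ, ⟨L 1, hL1⟩, hendpoint 0 (by simp) (by simp [hL0]),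
    hendpoint 1 (by simp) (by simp), LipschitzOnWith.of_dist_le_mul fun s hs t ht => ?_⟩
  refine (hdist _ (hτ s hs) _ (hτ t ht)).trans_eq ?_
  rw [hLτ s hs, hLτ t ht, ← mul_sub, abs_mul, abs_of_nonneg hL1, abs_sub_comm, Real.dist_eq]
  rfl

lemma isActionBound_of_lipschitzOnWith {ℓ : ℝ≥0} {S : ℝ} (hγ : LipschitzOnWith ℓ γ (Icc a b))
    (hS : ∀ t ∈ Icc a b, metricSlope E (γ t) ≤ ENNReal.ofReal S) :
    IsActionBound E γ (fun _ => max (ℓ : ℝ≥0∞) (ENNReal.ofReal S)) a b where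
  measurable := measurable_const
  lintegral_sq_lt_top := by
    rw [setLIntegral_const, Real.volume_Ioc]
    exact ENNReal.mul_lt_top (by finiteness) ENNReal.ofReal_lt_top
  edist_le s t hs hst ht := by
    rw [setLIntegral_const, Real.volume_Ioc]
    refine (hγ ⟨hs, hst.trans ht⟩ ⟨hs.trans hst, ht⟩).trans ?_
    rw [edist_comm, edist_dist, Real.dist_eq, abs_of_nonneg (sub_nonneg.2 hst)]
    gcongr
    exact le_max_left _ _
  metricSlope_le :=
    .of_forall fun t ht => (hS t (Ioo_subset_Icc_self ht)).trans (le_max_right _ _)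

lemma IsIntegralFlow.finiteActionJoined {κ : ℝ} {u : ℝ → X} (hE : Setting E)
    (hu : IsIntegralFlow E κ u) (h0 : E (u 0) < ⊤) : FiniteActionJoined E (u 0) (u 1) :=
  ⟨u, _, 0, 1, zero_lt_one, hu.isActionBound hE h0 1, rfl, rfl⟩

/-- The endpoints are joined through the time-one image of a Lipschitz curve under the flow, which
is again Lipschitz, by contraction, and along which the slope is bounded, by regularization. -/
lemma finiteActionJoined_of_acOn (hE : Setting E) (hγ : ACOn γ 0 1) (h0 : E (γ 0) < ⊤)
    (h1 : E (γ 1) < ⊤) : FiniteActionJoined E (γ 0) (γ 1) := by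
  obtain ⟨κ, hflow⟩ := hE.exists_isIntegralFlow
  choose U hU hU0 using hflow
  obtain ⟨η, ℓ, hη0, hη1, hη⟩ := hγ.exists_lipschitzOnWith_reparametrization
  have hjoin : ∀ x, E x < ⊤ → FiniteActionJoined E x (U x 1) := fun x hx => by
    have h := (hU x).finiteActionJoined hE (by rwa [hU0])
    rwa [hU0] at h
  obtain ⟨S, hS⟩ := (hU (γ 0)).exists_metricSlope_le hE (by rwa [hU0]) ℓ
  have hcontract : LipschitzWith (Real.exp κ).toNNReal fun x => U x 1 :=
    LipschitzWith.of_dist_le_mul fun x y => by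
      have h := (hU x).dist_le (hU y) le_rfl zero_le_one
      rwa [hU0, hU0, sub_zero, mul_one, ← Real.coe_toNNReal _ (Real.exp_pos κ).le] at h
  have hslope : ∀ t ∈ Icc (0 : ℝ) 1, metricSlope E (U (η t) 1) ≤ ENNReal.ofReal S := by
    refine fun t ht => hS _ (hU (η t)) ?_
    rw [hU0, hU0, ← hη0]
    refine (hη.dist_le_mul t ht 0 (by simp)).trans ?_
    rw [Real.dist_0_eq_abs, abs_of_nonneg ht.1]
    exact mul_le_of_le_one_right ℓ.2 ht.2
  have hmid : FiniteActionJoined E (U (η 0) 1) (U (η 1) 1) :=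
    ⟨_, _, 0, 1, zero_lt_one,
      isActionBound_of_lipschitzOnWith (hcontract.comp_lipschitzOnWith hη) hslope, rfl, rfl⟩
  rw [hη0, hη1] at hmid
  exact ((hjoin _ h0).trans hmid).trans (hjoin _ h1).symm

end Competitor

/-! ### Lower semicontinuity of the kinetic energy -/

section DisjointIntervals

open AbsolutelyContinuousOnInterval

variable {a b : ℝ}

lemma sum_dist_le_of_mem_disjWithin {I : ℕ × (ℕ → ℝ × ℝ)} (hab : a ≤ b)
    (hI : I ∈ disjWithin a b) :
    ∑ i ∈ Finset.range I.1, dist (I.2 i).1 (I.2 i).2 ≤ b - a := by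
  have hvol : ∀ i, volume (uIoc (I.2 i).1 (I.2 i).2) =
      ENNReal.ofReal (dist (I.2 i).1 (I.2 i).2) := fun i => by
    rw [uIoc, Real.volume_Ioc, max_sub_min_eq_abs', Real.dist_eq]
  rw [← ENNReal.ofReal_le_ofReal_iff (sub_nonneg.2 hab),
    ENNReal.ofReal_sum_of_nonneg fun _ _ => dist_nonneg]
  calc ∑ i ∈ Finset.range I.1, ENNReal.ofReal (dist (I.2 i).1 (I.2 i).2)
      = volume (⋃ i ∈ Finset.range I.1, uIoc (I.2 i).1 (I.2 i).2) := by
        rw [measure_biUnion_finset hI.2 fun _ _ => measurableSet_uIoc]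
        simp only [hvol]
    _ ≤ volume (uIoc a b) := measure_mono (biUnion_uIoc_subset_of_mem_disjWithin hI)
    _ = ENNReal.ofReal (b - a) := by rw [uIoc_of_le hab, Real.volume_Ioc]

lemma comp_mem_disjWithin {F : ℝ → ℝ} (hF : Monotone F) {I : ℕ × (ℕ → ℝ × ℝ)}
    (hI : I ∈ disjWithin a b) :
    (I.1, fun i => (F (I.2 i).1, F (I.2 i).2)) ∈ disjWithin (F a) (F b) := by
  refine ⟨fun i hi => ⟨(hF.monotoneOn _).mapsTo_uIcc (hI.1 i hi).1,
    (hF.monotoneOn _).mapsTo_uIcc (hI.1 i hi).2⟩, fun i hi j hj hij => ?_⟩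
  have hdisj := hI.2 hi hj hij
  simp only [Function.onFun, uIoc, Ioc_disjoint_Ioc, ← hF.map_max, ← hF.map_min] at hdisj ⊢
  exact hF hdisj

end DisjointIntervals

lemma lintegral_ofReal_deriv_le {Φ : ℝ → ℝ} (hΦ : Monotone Φ) {a b : ℝ} (hab : a ≤ b) :
    ∫⁻ t in Ioc a b, ENNReal.ofReal (deriv Φ t) ≤ ENNReal.ofReal (Φ b - Φ a) := by
  have hint := (hΦ.monotoneOn (uIcc a b)).intervalIntegrable_deriv
  rw [← ofReal_integral_eq_lintegral_ofReal
    ((intervalIntegrable_iff_integrableOn_Ioc_of_le hab).1 hint)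
    (.of_forall fun t => hΦ.deriv_nonneg), ← intervalIntegral.integral_of_le hab]
  have h := (hΦ.monotoneOn (uIcc a b)).intervalIntegral_deriv_mem_uIcc
  rw [uIcc_of_le (sub_nonneg.2 (hΦ hab))] at h
  exact ENNReal.ofReal_le_ofReal h.2

lemma exists_monotone_primitive {f : ℝ → ℝ≥0∞} {a b : ℝ} (hf : ∫⁻ t in Ioc a b, f t < ⊤) :
    ∃ Φ : ℝ → ℝ, Monotone Φ ∧ (∀ t, Φ t ∈ Icc 0 (∫⁻ t in Ioc a b, f t).toReal) ∧
      ∀ s t, a ≤ s → s ≤ t → t ≤ b → ∫⁻ r in Ioc s t, f r = ENNReal.ofReal (Φ t - Φ s) := by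
  have hle : ∀ t, ∫⁻ r in Ioc a (min t b), f r ≤ ∫⁻ t in Ioc a b, f t := fun t =>
    lintegral_mono_set (Ioc_subset_Ioc_right (min_le_right t b))
  have hlt : ∀ t, ∫⁻ r in Ioc a (min t b), f r ≠ ⊤ := fun t => ((hle t).trans_lt hf).ne
  refine ⟨fun t => (∫⁻ r in Ioc a (min t b), f r).toReal, fun s t hst => ?_, fun t =>
    ⟨ENNReal.toReal_nonneg, ENNReal.toReal_mono hf.ne (hle t)⟩, fun s t hs hst ht => ?_⟩
  · exact ENNReal.toReal_mono (hlt t)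
      (lintegral_mono_set (Ioc_subset_Ioc_right (min_le_min_right b hst)))
  · have hs' := hlt s
    have ht' := hlt t
    dsimp only
    rw [min_eq_left (hst.trans ht)] at hs' ⊢
    rw [min_eq_left ht] at ht' ⊢
    rw [ENNReal.ofReal_sub _ ENNReal.toReal_nonneg, ENNReal.ofReal_toReal hs',
      ENNReal.ofReal_toReal ht', ← lintegral_Ioc_add_lintegral_Ioc hs hst,
      ENNReal.add_sub_cancel_left hs']

section KineticBound

variable {X : Type*} [MetricSpace X] {γ : ℝ → X} {Φ : ℝ → ℝ} {a b : ℝ}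

/-- The increments of the increasing function `Φ` dominate the integrals of `|γ̇|²`, in the sense of
the Cauchy-Schwarz inequality. Unlike a bound on the speed itself, this passes to pointwise limits
of curves. -/
structure IsKineticBound (γ : ℝ → X) (Φ : ℝ → ℝ) (a b : ℝ) : Prop where
  monotone : Monotone Φ
  dist_sq_le : ∀ s t : ℝ, a ≤ s → s ≤ t → t ≤ b → dist (γ s) (γ t) ^ 2 ≤ (t - s) * (Φ t - Φ s)

lemma ACOn.exists_isKineticBound (h : ACOn γ a b)
    (hfin : ∫⁻ t in Ioc a b, metricSpeed γ t ^ 2 < ⊤) :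
    ∃ Φ, IsKineticBound γ Φ a b ∧
      ∀ t, Φ t ∈ Icc 0 (∫⁻ t in Ioc a b, metricSpeed γ t ^ 2).toReal := by
  obtain ⟨Φ, hmono, hrange, hΦ⟩ := exists_monotone_primitive hfin
  refine ⟨Φ, ⟨hmono, fun s t hs hst ht => ?_⟩, hrange⟩
  have hle := h.edist_sq_le hs hst ht
  have hst0 := sub_nonneg.2 hst
  rw [hΦ s t hs hst ht, ← ENNReal.ofReal_mul hst0, edist_dist,
    ← ENNReal.ofReal_pow dist_nonneg] at hle
  exact (ENNReal.ofReal_le_ofReal_iff (mul_nonneg hst0 (sub_nonneg.2 (hmono hst)))).1 hle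

namespace IsKineticBound

lemma dist_le_sqrt (h : IsKineticBound γ Φ a b) {s t : ℝ} (hs : s ∈ Icc a b) (ht : t ∈ Icc a b) :
    dist (γ s) (γ t) ≤ √(dist s t) * √(dist (Φ s) (Φ t)) := by
  wlog hst : s ≤ t generalizing s t with hwlog
  · rw [dist_comm, dist_comm s, dist_comm (Φ s)]
    exact hwlog ht hs (not_le.1 hst).le
  rw [← Real.sqrt_mul dist_nonneg, dist_comm s, dist_comm (Φ s), Real.dist_eq, Real.dist_eq,
    abs_of_nonneg (sub_nonneg.2 hst), abs_of_nonneg (sub_nonneg.2 (h.monotone hst))]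
  exact Real.le_sqrt_of_sq_le (h.dist_sq_le s t hs.1 hst ht.2)

lemma absolutelyContinuousOnInterval (h : IsKineticBound γ Φ a b) (hab : a ≤ b) :
    AbsolutelyContinuousOnInterval γ a b := by
  open AbsolutelyContinuousOnInterval in
  have hlength : Tendsto (fun I : ℕ × (ℕ → ℝ × ℝ) =>
      √(∑ i ∈ Finset.range I.1, dist (I.2 i).1 (I.2 i).2) * √(Φ b - Φ a))
      (totalLengthFilter ⊓ 𝓟 (disjWithin a b)) (𝓝 0) := by
    have hsum : Tendsto (fun I : ℕ × (ℕ → ℝ × ℝ) =>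
        ∑ i ∈ Finset.range I.1, dist (I.2 i).1 (I.2 i).2)
        (totalLengthFilter ⊓ 𝓟 (disjWithin a b)) (𝓝 0) := tendsto_comap.mono_left inf_le_left
    simpa using hsum.sqrt.mul_const √(Φ b - Φ a)
  refine squeeze_zero' (.of_forall fun _ => Finset.sum_nonneg fun _ _ => dist_nonneg) ?_ hlength
  filter_upwards [mem_inf_of_right (mem_principal_self _)] with I hI
  have hmem := hI.1
  rw [uIcc_of_le hab] at hmem
  calc ∑ i ∈ Finset.range I.1, dist (γ (I.2 i).1) (γ (I.2 i).2)
      ≤ ∑ i ∈ Finset.range I.1,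
          √(dist (I.2 i).1 (I.2 i).2) * √(dist (Φ (I.2 i).1) (Φ (I.2 i).2)) :=
        Finset.sum_le_sum fun i hi => h.dist_le_sqrt (hmem i hi).1 (hmem i hi).2
    _ ≤ _ := Real.sum_sqrt_mul_sqrt_le _ (fun _ => dist_nonneg) fun _ => dist_nonneg
    _ ≤ _ := by
        gcongr
        exact sum_dist_le_of_mem_disjWithin (h.monotone hab) (comp_mem_disjWithin h.monotone hI)

lemma rightSpeedLE (h : IsKineticBound γ Φ a b) {t C : ℝ} (ht : t ∈ Ico a b)
    (hΦ : DifferentiableAt ℝ Φ t) (hC : √(deriv Φ t) < C) : RightSpeedLE γ t C := by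
  have hC0 : 0 < C := (Real.sqrt_nonneg _).trans_lt hC
  have hslope := ((hasDerivAt_iff_tendsto_slope.1 hΦ.hasDerivAt).mono_left
    (nhdsGT_le_nhdsNE t)).eventually (gt_mem_nhds ((Real.sqrt_lt' hC0).1 hC))
  filter_upwards [hslope, Ioo_mem_nhdsGT ht.2] with s hs hmem
  have hst : 0 < s - t := sub_pos.2 hmem.1
  rw [slope_def_field, div_lt_iff₀ hst] at hs
  refine abs_le_of_sq_le_sq' ?_ (by positivity) |>.2
  rw [dist_comm]
  calc dist (γ t) (γ s) ^ 2 ≤ (s - t) * (Φ s - Φ t) := h.dist_sq_le t s ht.1 hmem.1.le hmem.2.le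
    _ ≤ (s - t) * (C ^ 2 * (s - t)) := by gcongr
    _ = (C * (s - t)) ^ 2 := by ring

lemma mono (h : IsKineticBound γ Φ a b) {c d : ℝ} (hac : a ≤ c) (hdb : d ≤ b) :
    IsKineticBound γ Φ c d :=
  ⟨h.monotone, fun s t hs hst ht => h.dist_sq_le s t (hac.trans hs) hst (ht.trans hdb)⟩

lemma edist_le (h : IsKineticBound γ Φ a b) (hab : a ≤ b) :
    edist (γ a) (γ b) ≤ ∫⁻ t in Ioc a b, ENNReal.ofReal √(deriv Φ t) := by
  refine edist_le_lintegral_of_rightSpeedLE hab (h.absolutelyContinuousOnInterval hab) ?_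
  filter_upwards [h.monotone.ae_differentiableAt] with t hd ht C hC
  exact h.rightSpeedLE (Ioo_subset_Ico_self ht) hd
    ((ENNReal.ofReal_lt_ofReal_iff_of_nonneg (Real.sqrt_nonneg _)).1 hC)

lemma lintegral_sqrt_deriv_sq_le (h : IsKineticBound γ Φ a b) (hab : a ≤ b) :
    ∫⁻ t in Ioc a b, ENNReal.ofReal √(deriv Φ t) ^ 2 ≤ ENNReal.ofReal (Φ b - Φ a) := by
  refine (lintegral_congr fun t => ?_).trans_le (lintegral_ofReal_deriv_le h.monotone hab)
  rw [← ENNReal.ofReal_pow (Real.sqrt_nonneg _), Real.sq_sqrt h.monotone.deriv_nonneg]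

lemma isSquareSpeedBound (h : IsKineticBound γ Φ a b) (hab : a ≤ b) :
    IsSquareSpeedBound γ (fun t => ENNReal.ofReal √(deriv Φ t)) a b where
  measurable := (measurable_deriv Φ).sqrt.ennreal_ofReal
  lintegral_sq_lt_top := (h.lintegral_sqrt_deriv_sq_le hab).trans_lt ENNReal.ofReal_lt_top
  edist_le _ _ hs hst ht := (h.mono hs ht).edist_le hst

lemma kineticEnergy_le (h : IsKineticBound γ Φ 0 1) :
    kineticEnergy γ ≤ 2⁻¹ * ENNReal.ofReal (Φ 1 - Φ 0) := by
  have hspeed := h.isSquareSpeedBound zero_le_one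
  have hle := hspeed.metricSpeed_le zero_le_one
  rw [kineticEnergy, if_pos hspeed.acOn]
  rw [← restrict_Ioc_eq_restrict_Icc] at hle ⊢
  gcongr
  exact (lintegral_mono_ae (hle.mono fun t ht => pow_le_pow_left' ht 2)).trans
    (h.lintegral_sqrt_deriv_sq_le zero_le_one)

end IsKineticBound

lemma acOn_of_kineticEnergy_lt_top (h : kineticEnergy γ < ⊤) : ACOn γ 0 1 := by
  by_contra hγ
  exact h.ne (if_neg hγ)

lemma lintegral_metricSpeed_sq (h : kineticEnergy γ < ⊤) :
    ∫⁻ t in Ioc 0 1, metricSpeed γ t ^ 2 = 2 * kineticEnergy γ := by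
  rw [kineticEnergy, if_pos (acOn_of_kineticEnergy_lt_top h), restrict_Ioc_eq_restrict_Icc,
    ← mul_assoc, ENNReal.mul_inv_cancel two_ne_zero ENNReal.ofNat_ne_top, one_mul]

lemma exists_isKineticBound_of_kineticEnergy_le {K : ℝ≥0} (h : kineticEnergy γ ≤ K) :
    ∃ Φ, IsKineticBound γ Φ 0 1 ∧ ∀ t, Φ t ∈ Icc (0 : ℝ) (2 * K) := by
  have hlt := h.trans_lt ENNReal.coe_lt_top
  have hle : ∫⁻ t in Ioc 0 1, metricSpeed γ t ^ 2 ≤ ((2 * K : ℝ≥0) : ℝ≥0∞) := by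
    rw [lintegral_metricSpeed_sq hlt, ENNReal.coe_mul]
    gcongr
    rfl
  obtain ⟨Φ, hΦ, hrange⟩ := (acOn_of_kineticEnergy_lt_top hlt).exists_isKineticBound
    (hle.trans_lt ENNReal.coe_lt_top)
  refine ⟨Φ, hΦ, fun t => ⟨(hrange t).1, (hrange t).2.trans ?_⟩⟩
  simpa using ENNReal.toReal_mono ENNReal.coe_ne_top hle

/-- The functions `F i` take values in a fixed compact interval, so they converge pointwise along an
ultrafilter, and the bounds pass to the limit. -/
lemma IsKineticBound.exists_of_ultrafilter {ι : Type*} {U : Ultrafilter ι} {c : ι → ℝ → X}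
    {F : ι → ℝ → ℝ} {B : ℝ}
    (hF : ∀ᶠ i in U, IsKineticBound (c i) (F i) a b ∧ ∀ t, F i t ∈ Icc 0 B)
    (hγ : ∀ s ∈ Icc a b, ∀ t ∈ Icc a b,
      edist (γ s) (γ t) ≤ liminf (fun i => edist (c i s) (c i t)) U) :
    ∃ Φ, IsKineticBound γ Φ a b ∧ ∀ t, Φ t ∈ Icc 0 B := by
  have hlim : ∀ t, ∃ y ∈ Icc 0 B, Tendsto (fun i => F i t) U (𝓝 y) := fun t =>
    isCompact_Icc.ultrafilter_le_nhds (U.map fun i => F i t)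
      (tendsto_principal.2 (hF.mono fun i hi => hi.2 t))
  choose Φ hΦ htend using hlim
  have hmono : Monotone Φ := fun s t hst => le_of_tendsto_of_tendsto (htend s) (htend t)
    (hF.mono fun i hi => hi.1.monotone hst)
  refine ⟨Φ, ⟨hmono, fun s t hs hst ht => ?_⟩, hΦ⟩
  have hsqrt : Tendsto (fun i => ENNReal.ofReal √((t - s) * (F i t - F i s))) U
      (𝓝 (ENNReal.ofReal √((t - s) * (Φ t - Φ s)))) :=
    ENNReal.tendsto_ofReal (((htend t).sub (htend s)).const_mul (t - s)).sqrt
  have hle : edist (γ s) (γ t) ≤ ENNReal.ofReal √((t - s) * (Φ t - Φ s)) := by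
    refine (hγ s ⟨hs, hst.trans ht⟩ t ⟨hs.trans hst, ht⟩).trans ?_
    rw [← hsqrt.liminf_eq]
    refine liminf_le_liminf (hF.mono fun i hi => ?_)
    rw [edist_dist]
    exact ENNReal.ofReal_le_ofReal (Real.le_sqrt_of_sq_le (hi.1.dist_sq_le s t hs hst ht))
  rw [edist_dist, ENNReal.ofReal_le_ofReal_iff (Real.sqrt_nonneg _)] at hle
  exact (Real.le_sqrt dist_nonneg
    (mul_nonneg (sub_nonneg.2 hst) (sub_nonneg.2 (hmono hst)))).1 hle

lemma kineticEnergy_le_liminf {ι : Type*} {l : Filter ι} {c : ι → ℝ → X}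
    (hγ : ∀ s ∈ Icc (0 : ℝ) 1, ∀ t ∈ Icc (0 : ℝ) 1,
      edist (γ s) (γ t) ≤ liminf (fun i => edist (c i s) (c i t)) l) :
    kineticEnergy γ ≤ liminf (fun i => kineticEnergy (c i)) l := by
  refine le_of_forall_gt_imp_ge_of_dense fun K hK => ?_
  induction K with
  | top => exact le_top
  | coe K =>
    have hfreq : ∃ᶠ i in l, i ∈ {i | kineticEnergy (c i) ≤ K} :=
      (frequently_lt_of_liminf_lt (by isBoundedDefault) hK).mono fun i hi => le_of_lt hi
    have := frequently_mem_iff_neBot.1 hfreq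
    set U := Ultrafilter.of (l ⊓ 𝓟 {i | kineticEnergy (c i) ≤ K})
    have hU : ↑U ≤ l ⊓ 𝓟 {i | kineticEnergy (c i) ≤ K} := Ultrafilter.of_le _
    choose! F hF using fun i (hi : kineticEnergy (c i) ≤ K) =>
      exists_isKineticBound_of_kineticEnergy_le hi
    have hle : ∀ᶠ i in U, kineticEnergy (c i) ≤ K := le_principal_iff.1 (hU.trans inf_le_right)
    obtain ⟨Φ, hΦ, hrange⟩ := IsKineticBound.exists_of_ultrafilter (hle.mono hF)
      fun s hs t ht => (hγ s hs t ht).trans (liminf_le_liminf_of_le (hU.trans inf_le_left))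
    calc kineticEnergy γ ≤ 2⁻¹ * ENNReal.ofReal (Φ 1 - Φ 0) := hΦ.kineticEnergy_le
      _ ≤ 2⁻¹ * ENNReal.ofReal (2 * K) := by gcongr; linarith [(hrange 1).2, (hrange 0).1]
      _ = K := by
        rw [ENNReal.ofReal_mul zero_le_two, ENNReal.ofReal_coe_nnreal, ENNReal.ofReal_ofNat,
          ← mul_assoc, ENNReal.inv_mul_cancel two_ne_zero ENNReal.ofNat_ne_top, one_mul]

end KineticBound

/-! ### The direct method -/

lemma exists_diagonal_subsequence {p : ℕ → (ℕ → ℕ) → Prop}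
    (hex : ∀ k φ, StrictMono φ → ∃ θ : ℕ → ℕ, StrictMono θ ∧ p k (φ ∘ θ))
    (htail : ∀ k φ ψ ρ, p k φ → Tendsto ρ atTop atTop → ψ =ᶠ[atTop] φ ∘ ρ → p k ψ) :
    ∃ φ : ℕ → ℕ, StrictMono φ ∧ ∀ k, p k φ := by
  choose! θ hθ hp using hex
  let Ψ : ℕ → ℕ → ℕ := Nat.rec id fun k φ => φ ∘ θ k φ
  have hΨ : ∀ k, StrictMono (Ψ k) := fun k => by
    induction k with
    | zero => exact strictMono_id
    | succ k ih => exact ih.comp (hθ k _ ih)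
  have hfactor : ∀ k j, ∃ ρ : ℕ → ℕ, StrictMono ρ ∧ Ψ (k + j) = Ψ k ∘ ρ := fun k j => by
    induction j with
    | zero => exact ⟨id, strictMono_id, rfl⟩
    | succ j ih =>
      obtain ⟨ρ, hρ, h⟩ := ih
      refine ⟨ρ ∘ θ (k + j) (Ψ (k + j)), hρ.comp (hθ _ _ (hΨ _)), ?_⟩
      rw [← Function.comp_assoc, ← h]
      rfl
  refine ⟨fun n => Ψ n n, strictMono_nat_of_lt_succ fun n => ?_, fun k => ?_⟩
  · exact hΨ n ((Nat.lt_succ_self n).trans_le ((hθ n _ (hΨ n)).id_le (n + 1)))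
  · choose ρ hρ hΨρ using hfactor (k + 1)
    refine htail k (Ψ (k + 1)) _ (fun n => ρ (n - (k + 1)) n) (hp k _ (hΨ k))
      (tendsto_atTop_mono (fun n => (hρ _).id_le n) tendsto_id) ?_
    filter_upwards [eventually_ge_atTop (k + 1)] with n hn
    have h := congrFun (hΨρ (n - (k + 1))) n
    rwa [Nat.add_sub_cancel' hn] at h

section WeakTopology

variable {X : Type*} [MetricSpace X] {N : X → Filter X}

/-- `N` is the family of neighbourhood filters of a topology in which bounded sequences have
convergent subsequences and the distance is sequentially lower semicontinuous. Only the filters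
are recorded, so that the topological notions on `X` remain those of the metric. -/
structure IsWeakNhds (N : X → Filter X) : Prop where
  pure_le : ∀ x, pure x ≤ N x
  exists_subseq : ∀ u : ℕ → X, Bornology.IsBounded (range u) →
    ∃ (z : X) (φ : ℕ → ℕ), StrictMono φ ∧ Tendsto (u ∘ φ) atTop (N z)
  edist_le_liminf : ∀ (u v : ℕ → X) (x y : X), Tendsto u atTop (N x) → Tendsto v atTop (N y) →
    edist x y ≤ liminf (fun n => edist (u n) (v n)) atTop

namespace IsWeakNhds

variable (hN : IsWeakNhds N)
include hN

lemma tendsto_const (x : X) : Tendsto (fun _ : ℕ => x) atTop (N x) :=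
  tendsto_const_pure.mono_right (hN.pure_le x)

lemma dist_le {u v : ℕ → X} {x y : X} {C : ℝ} (hu : Tendsto u atTop (N x))
    (hv : Tendsto v atTop (N y)) (h : ∀ᶠ n in atTop, dist (u n) (v n) ≤ C) : dist x y ≤ C := by
  have hC : 0 ≤ C := dist_nonneg.trans h.exists.choose_spec
  rw [← ENNReal.ofReal_le_ofReal_iff hC, ← edist_dist]
  refine (hN.edist_le_liminf u v x y hu hv).trans
    (((liminf_le_liminf (h.mono fun n hn => ?_)).trans_eq (liminf_const _)))
  rw [edist_dist]
  exact ENNReal.ofReal_le_ofReal hn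

lemma eq_of_tendsto {u : ℕ → X} {x z : X} (hz : Tendsto u atTop (N z))
    (hx : Tendsto u atTop (𝓝 x)) : z = x :=
  eq_of_forall_dist_le fun _ hδ => hN.dist_le hz (hN.tendsto_const x)
    ((Metric.tendsto_nhds.1 hx _ hδ).mono fun _ hn => hn.le)

lemma lowerSemicontinuous {f : X → ℝ≥0∞}
    (hf : ∀ (u : ℕ → X) (x : X), Tendsto u atTop (N x) →
      f x ≤ liminf (fun n => f (u n)) atTop) : LowerSemicontinuous f := by
  intro x c hc
  by_contra hcon
  obtain ⟨v, hv, hvc⟩ := exists_seq_forall_of_frequently (not_eventually.1 hcon)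
  obtain ⟨z, φ, hφ, hz⟩ := hN.exists_subseq v (Metric.isBounded_range_of_tendsto v hv)
  obtain rfl := hN.eq_of_tendsto hz (hv.comp hφ.tendsto_atTop)
  have hle : liminf (fun n => f (v (φ n))) atTop ≤ c :=
    (liminf_le_liminf (.of_forall fun n => not_lt.1 (hvc (φ n)))).trans_eq (liminf_const c)
  exact hc.not_ge ((hf _ _ hz).trans hle)

/-- Ascoli-Arzelà for the weak topology. -/
lemma exists_subseq_tendsto_of_equicontinuous {T : Type*} [TopologicalSpace T]
    [TopologicalSpace.SeparableSpace T] [Nonempty T] {c : ℕ → T → X} (hc : Equicontinuous c)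
    (hb : ∀ t, Bornology.IsBounded (range fun n => c n t)) :
    ∃ (γ : T → X) (φ : ℕ → ℕ), StrictMono φ ∧
      ∀ t, Tendsto (fun n => c (φ n) t) atTop (N (γ t)) := by
  have hsub : ∀ (t : T) (ψ : ℕ → ℕ), ∃ (z : X) (θ : ℕ → ℕ), StrictMono θ ∧
      Tendsto (fun n => c (ψ (θ n)) t) atTop (N z) := fun t ψ =>
    hN.exists_subseq _ ((hb t).subset (range_comp_subset_range ψ fun n => c n t))
  set d : ℕ → T := TopologicalSpace.denseSeq T
  obtain ⟨φ, hφ, hdense⟩ := exists_diagonal_subsequence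
    (p := fun k φ => ∃ z, Tendsto (fun n => c (φ n) (d k)) atTop (N z))
    (fun k φ _ => (exists_comm.1 (hsub (d k) φ)).imp fun _ ⟨z, hθ, hz⟩ => ⟨hθ, z, hz⟩)
    fun k φ ψ ρ ⟨z, hz⟩ hρ hψ => ⟨z, (hz.comp hρ).congr' (hψ.mono fun n hn => by simp [hn])⟩
  choose z hz using hdense
  have hunique : ∀ (t : T) (ψ ψ' : ℕ → ℕ) (y y' : X), Tendsto ψ atTop atTop →
      Tendsto ψ' atTop atTop → Tendsto (fun n => c (φ (ψ n)) t) atTop (N y) →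
      Tendsto (fun n => c (φ (ψ' n)) t) atTop (N y') → y = y' := by
    intro t ψ ψ' y y' hψ hψ' hy hy'
    refine eq_of_forall_dist_le fun δ hδ => ?_
    obtain ⟨k, hk⟩ := (TopologicalSpace.denseRange_denseSeq T).exists_mem_open isOpen_interior
      ⟨t, mem_interior_iff_mem_nhds.2 (Metric.equicontinuousAt_iff_right.1 (hc t) _ (half_pos hδ))⟩
    have hclose := interior_subset hk
    linarith [dist_triangle_right y y' (z k),
      hN.dist_le hy ((hz k).comp hψ) (.of_forall fun n => (hclose (φ (ψ n))).le),
      hN.dist_le hy' ((hz k).comp hψ') (.of_forall fun n => (hclose (φ (ψ' n))).le)]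
  choose γ θ hθ hγ using fun t => hsub t φ
  refine ⟨γ, φ, hφ, fun t => tendsto_of_subseq_tendsto fun ns hns => ?_⟩
  obtain ⟨y, θ', hθ', hy⟩ := hsub t (fun n => φ (ns n))
  obtain rfl := hunique t (θ t) (fun n => ns (θ' n)) _ _ (hθ t).tendsto_atTop
    (hns.comp hθ'.tendsto_atTop) (hγ t) hy
  exact ⟨θ', hy⟩

end IsWeakNhds

lemma WeakTopologyAssumption.exists_isWeakNhds {E : X → EReal} (hσ : WeakTopologyAssumption E) :
    ∃ N : X → Filter X, IsWeakNhds N ∧ ∀ (u : ℕ → X) (x : X), Tendsto u atTop (N x) →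
      metricSlope E x ≤ liminf (fun n => metricSlope E (u n)) atTop := by
  obtain ⟨σ, -, hsubseq, hdist, hslope⟩ := hσ
  exact ⟨@nhds X σ, ⟨@pure_le_nhds X σ, hsubseq, hdist⟩, hslope⟩

end WeakTopology

section Action

variable {X : Type*} [MetricSpace X] {E : X → EReal} {γ : ℝ → X}

lemma dist_le_of_kineticEnergy_le {K : ℝ≥0} (h : kineticEnergy γ ≤ K) {s t : ℝ}
    (hs : s ∈ Icc (0 : ℝ) 1) (ht : t ∈ Icc (0 : ℝ) 1) :
    dist (γ s) (γ t) ≤ √(dist s t) * √(2 * K) := by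
  obtain ⟨Φ, hΦ, hrange⟩ := exists_isKineticBound_of_kineticEnergy_le h
  refine (hΦ.dist_le_sqrt hs ht).trans ?_
  gcongr
  simpa using Real.dist_le_of_mem_Icc (hrange s) (hrange t)

lemma IsWeakNhds.exists_subseq_tendsto_of_kineticEnergy_le {N : X → Filter X}
    (hN : IsWeakNhds N) {c : ℕ → ℝ → X} {x : X} {K : ℝ≥0} (hK : ∀ n, kineticEnergy (c n) ≤ K)
    (h0 : ∀ n, c n 0 = x) :
    ∃ (γ : ℝ → X) (φ : ℕ → ℕ), StrictMono φ ∧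
      ∀ t ∈ Icc (0 : ℝ) 1, Tendsto (fun n => c (φ n) t) atTop (N (γ t)) := by
  set C : ℝ := √(2 * K)
  have hdist : ∀ (s t : Icc (0 : ℝ) 1) (n : ℕ), dist (c n s) (c n t) ≤ √(dist s t) * C :=
    fun s t n => dist_le_of_kineticEnergy_le (hK n) s.2 t.2
  have hmodulus : Tendsto (fun r => √r * C) (𝓝 0) (𝓝 0) := by
    simpa using (Real.continuous_sqrt.mul_const C).tendsto 0
  obtain ⟨γ, φ, hφ, hγ⟩ := hN.exists_subseq_tendsto_of_equicontinuous
    (Metric.equicontinuous_of_continuity_modulus _ hmodulus (fun n (t : Icc (0 : ℝ) 1) => c n t)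
      hdist) fun t => (Metric.isBounded_closedBall (x := x)).subset
        (range_subset_iff.2 fun n => h0 n ▸ hdist t ⟨0, le_rfl, zero_le_one⟩ n)
  refine ⟨IccExtend zero_le_one γ, φ, hφ, fun t ht => ?_⟩
  rw [IccExtend_of_mem _ _ ht]
  exact hγ ⟨t, ht⟩

lemma fisherInformation_le_liminf {c : ℕ → ℝ → X} (hE : LowerSemicontinuous (metricSlope E))
    (hc : ∀ n, ContinuousOn (c n) (Icc 0 1))
    (h : ∀ t ∈ Icc (0 : ℝ) 1,
      metricSlope E (γ t) ≤ liminf (fun n => metricSlope E (c n t)) atTop) :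
    fisherInformation E γ ≤ liminf (fun n => fisherInformation E (c n)) atTop := by
  simp only [fisherInformation]
  rw [ENNReal.liminf_const_mul_of_ne_top (by simp)]
  gcongr
  calc ∫⁻ t in Icc (0 : ℝ) 1, metricSlope E (γ t) ^ 2
      ≤ ∫⁻ t in Icc (0 : ℝ) 1, liminf (fun n => metricSlope E (c n t) ^ 2) atTop := by
        refine setLIntegral_mono' measurableSet_Icc fun t ht => ?_
        refine (pow_le_pow_left' (h t ht) 2).trans_eq ?_
        exact (pow_left_mono 2).map_liminf_of_continuousAt _
          (ENNReal.continuous_pow 2).continuousAt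
    _ ≤ _ := lintegral_liminf_le' fun n =>
        (aemeasurable_comp_of_lowerSemicontinuous hE zero_le_one (hc n)).pow_const 2

lemma liminf_add_liminf_le (f g : ℕ → ℝ≥0∞) :
    liminf f atTop + liminf g atTop ≤ liminf (fun n => f n + g n) atTop := by
  have hmono : ∀ h : ℕ → ℝ≥0∞, Monotone fun n => ⨅ i, ⨅ (_ : i ≥ n), h i := fun h n m hnm =>
    le_iInf₂ fun i hi => iInf₂_le i (hnm.trans hi)
  simp only [liminf_eq_iSup_iInf_of_nat]
  rw [ENNReal.iSup_add_iSup_of_monotone (hmono f) (hmono g)]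
  exact iSup_mono fun n => le_iInf₂ fun i hi => add_le_add (iInf₂_le i hi) (iInf₂_le i hi)

lemma schrodingerAction_le_of_tendsto {ε : ℝ} {c : ℕ → ℝ → X} {A : ℝ≥0∞}
    (hkin : kineticEnergy γ ≤ liminf (fun n => kineticEnergy (c n)) atTop)
    (hfisher : fisherInformation E γ ≤ liminf (fun n => fisherInformation E (c n)) atTop)
    (hA : Tendsto (fun n => schrodingerAction E ε (c n)) atTop (𝓝 A)) :
    schrodingerAction E ε γ ≤ A := by
  rw [← hA.liminf_eq]
  refine le_trans ?_ (liminf_add_liminf_le _ _)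
  rw [ENNReal.liminf_const_mul_of_ne_top ENNReal.ofReal_ne_top]
  exact add_le_add hkin (by gcongr)

lemma exists_minimizing_seq {ε : ℝ} {x y : X}
    (hfin : ∃ γ ∈ curvesJoining x y, schrodingerAction E ε γ < ⊤) :
    ∃ (c : ℕ → ℝ → X) (K : ℝ≥0), (∀ n, c n ∈ curvesJoining x y) ∧
      (∀ n, kineticEnergy (c n) ≤ K) ∧ Tendsto (fun n => schrodingerAction E ε (c n)) atTop
        (𝓝 (sInf (schrodingerAction E ε '' curvesJoining x y))) := by
  obtain ⟨γ₀, hγ₀, hlt⟩ := hfin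
  set A := sInf (schrodingerAction E ε '' curvesJoining x y)
  have hA : A < ⊤ := (sInf_le (mem_image_of_mem _ hγ₀)).trans_lt hlt
  obtain ⟨K, hAK, -⟩ := ENNReal.lt_iff_exists_nnreal_btwn.1 hA
  obtain ⟨u, -, hu, hmem⟩ := exists_seq_tendsto_sInf ⟨_, mem_image_of_mem _ hγ₀⟩
    (OrderBot.bddBelow (schrodingerAction E ε '' curvesJoining x y))
  choose c hc hcu using hmem
  obtain ⟨n₀, hn₀⟩ := eventually_atTop.1 (hu.eventually (gt_mem_nhds hAK))
  refine ⟨fun n => c (n + n₀), K, fun n => hc _, fun n => ?_, ?_⟩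
  · exact le_self_add.trans ((hcu _).trans_lt (hn₀ _ (Nat.le_add_left _ _))).le
  · exact (hu.comp (tendsto_add_atTop_nat n₀)).congr fun n => (hcu _).symm

lemma schrodingerSolvable_of_action_lt_top (hσ : WeakTopologyAssumption E) {ε : ℝ} {x y : X}
    (hfin : ∃ γ ∈ curvesJoining x y, schrodingerAction E ε γ < ⊤) :
    SchrodingerSolvable E ε x y := by
  obtain ⟨N, hN, hslope⟩ := hσ.exists_isWeakNhds
  obtain ⟨c, K, hc, hK, hA⟩ := exists_minimizing_seq hfin
  obtain ⟨γ, φ, hφ, hγ⟩ := hN.exists_subseq_tendsto_of_kineticEnergy_le hK fun n => (hc n).2.1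
  have hkin : kineticEnergy γ ≤ liminf (fun n => kineticEnergy (c (φ n))) atTop :=
    kineticEnergy_le_liminf fun s hs t ht => hN.edist_le_liminf _ _ _ _ (hγ s hs) (hγ t ht)
  have hfisher : fisherInformation E γ ≤ liminf (fun n => fisherInformation E (c (φ n))) atTop :=
    fisherInformation_le_liminf (hN.lowerSemicontinuous hslope) (fun n => (hc _).1)
      fun t ht => hslope _ _ (hγ t ht)
  have hle := schrodingerAction_le_of_tendsto hkin hfisher (hA.comp hφ.tendsto_atTop)
  obtain ⟨γ₀, hγ₀, hlt⟩ := hfin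
  have hAlt : schrodingerAction E ε γ < ⊤ :=
    (hle.trans (sInf_le (mem_image_of_mem _ hγ₀))).trans_lt hlt
  have hconst : ∀ {t z}, t ∈ Icc (0 : ℝ) 1 → (∀ n, c n t = z) → γ t = z := fun {t z} ht hz =>
    hN.eq_of_tendsto (hγ t ht) (by simp only [hz, tendsto_const_nhds])
  refine ⟨γ, ⟨?_, hconst ⟨le_rfl, zero_le_one⟩ fun n => (hc n).2.1,
    hconst ⟨zero_le_one, le_rfl⟩ fun n => (hc n).2.2⟩, hAlt,
    fun η hη => hle.trans (sInf_le (mem_image_of_mem _ hη))⟩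
  exact (acOn_of_kineticEnergy_lt_top (le_self_add.trans_lt hAlt)).continuousOn zero_le_one

end Action

/-! ### Curves of finite action have endpoints of finite energy -/

lemma bddAbove_range_of_succ_le {e φ : ℕ → ℝ} {C m : ℝ} (hC : 0 ≤ C) (hφ : ∀ k, m ≤ φ k)
    (he : ∀ k, e (k + 1) ≤ e k + C * (φ k - φ (k + 2))) : BddAbove (range e) := by
  have hanti : Antitone fun k => e k + C * (φ k + φ (k + 1)) :=
    antitone_nat_of_succ_le fun k => by linarith [he k]
  refine ⟨e 0 + C * (φ 0 + φ 1) - C * (m + m), forall_mem_range.2 fun k => ?_⟩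
  have hk : e k + C * (φ k + φ (k + 1)) ≤ e 0 + C * (φ 0 + φ 1) := hanti k.zero_le
  have hm : C * (m + m) ≤ C * (φ k + φ (k + 1)) :=
    mul_le_mul_of_nonneg_left (add_le_add (hφ _) (hφ _)) hC
  linarith

section FiniteEnergyEndpoints

variable {X : Type*} [MetricSpace X] {E : X → EReal} {γ : ℝ → X} {Φ Ψ : ℝ → ℝ}

lemma IsIntegralFlow.energy_le_add_mul {κ : ℝ} {u : ℝ → X} (hE : Setting E)
    (hu : IsIntegralFlow E κ u) {y : X} {r n : ℝ} (hx : metricSlope E (u 0) < ⊤) (hy : E y < ⊤)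
    (hr : r ∈ Ioc 0 1) (hS : r / 4 * (metricSlope E (u 0)).toReal ^ 2 ≤ n)
    (hd : dist (u 0) y ^ 2 ≤ r * n) :
    (E (u 0)).toReal ≤ (E y).toReal + (3 + κ) * n := by
  have hκ := hu.nonneg
  have hglobal := hu.energy_le_of_metricSlope_lt_top hE hx hy
  set S := (metricSlope E (u 0)).toReal
  set d := dist (u 0) y
  have hn : 0 ≤ n := nonneg_of_mul_nonneg_right ((sq_nonneg d).trans hd) hr.1
  have hyoung : S * d ≤ 5 / 2 * n := by
    refine le_of_mul_le_mul_left ?_ hr.1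
    have hmul := mul_le_mul_of_nonneg_left hS hr.1.le
    nlinarith [sq_nonneg (r / 4 * S - d)]
  have hquad : κ / 2 * d ^ 2 ≤ κ / 2 * n :=
    mul_le_mul_of_nonneg_left (hd.trans (mul_le_of_le_one_left hn hr.2)) (by positivity)
  linarith [mul_nonneg hκ hn]

/-- The increments of `Φ` dominate both terms of the action of `γ` on subintervals of `[0, 1]`. -/
structure IsActionPrimitive (E : X → EReal) (γ : ℝ → X) (Φ : ℝ → ℝ) : Prop
    extends IsKineticBound γ Φ 0 1 where
  lintegral_le : ∀ s t : ℝ, 0 ≤ s → s ≤ t → t ≤ 1 →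
    ∫⁻ r in Ioc s t, metricSlope E (γ r) ^ 2 ≤ ENNReal.ofReal (Φ t - Φ s)

lemma IsKineticBound.add {a b : ℝ} (h : IsKineticBound γ Φ a b) (hΨ : Monotone Ψ) :
    IsKineticBound γ (Φ + Ψ) a b := by
  refine ⟨h.monotone.add hΨ, fun s t hs hst ht => (h.dist_sq_le s t hs hst ht).trans ?_⟩
  refine mul_le_mul_of_nonneg_left ?_ (sub_nonneg.2 hst)
  linarith [hΨ hst, Pi.add_apply Φ Ψ s, Pi.add_apply Φ Ψ t]

lemma exists_isActionPrimitive {ε : ℝ} (hε : ε ≠ 0) (h : schrodingerAction E ε γ < ⊤) :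
    ∃ Φ, IsActionPrimitive E γ Φ := by
  obtain ⟨hkin, hfish⟩ := ENNReal.add_lt_top.1 h
  lift kineticEnergy γ to ℝ≥0 using hkin.ne with K hK
  obtain ⟨Φ, hΦ, -⟩ := exists_isKineticBound_of_kineticEnergy_le hK.ge
  have hslope : ∫⁻ t in Ioc (0 : ℝ) 1, metricSlope E (γ t) ^ 2 < ⊤ := by
    have hfisher : fisherInformation E γ < ⊤ :=
      ENNReal.lt_top_of_mul_ne_top_right hfish.ne (by simpa using hε)
    rw [fisherInformation, ← restrict_Ioc_eq_restrict_Icc] at hfisher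
    exact ENNReal.lt_top_of_mul_ne_top_right hfisher.ne (by simp)
  obtain ⟨Ψ, hΨ, -, hint⟩ := exists_monotone_primitive hslope
  refine ⟨Φ + Ψ, hΦ.add hΨ, fun s t hs hst ht => ?_⟩
  rw [hint s t hs hst ht]
  refine ENNReal.ofReal_le_ofReal ?_
  linarith [hΦ.monotone hst, Pi.add_apply Φ Ψ s, Pi.add_apply Φ Ψ t]

namespace IsActionPrimitive

lemma reverse (h : IsActionPrimitive E γ Φ) :
    IsActionPrimitive E (fun t => γ (1 - t)) (fun t => -Φ (1 - t)) := by
  refine ⟨⟨fun s t hst => neg_le_neg (h.monotone (by linarith)), fun s t hs hst ht => ?_⟩,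
    fun s t hs hst ht => ?_⟩
  · rw [dist_comm]
    convert h.dist_sq_le (1 - t) (1 - s) (by linarith) (by linarith) (by linarith) using 1
    ring
  · rw [lintegral_comp_sub_left 1 s t fun r => metricSlope E (γ r) ^ 2, neg_sub_neg]
    exact h.lintegral_le _ _ (by linarith) (by linarith) (by linarith)

lemma continuousOn (h : IsActionPrimitive E γ Φ) : ContinuousOn γ (Icc 0 1) :=
  (h.isSquareSpeedBound zero_le_one).acOn.continuousOn zero_le_one

lemma exists_mul_metricSlope_sq_le (h : IsActionPrimitive E γ Φ)
    (hE : LowerSemicontinuous (metricSlope E)) {a b : ℝ} (ha : 0 ≤ a) (hab : a < b) (hb : b ≤ 1) :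
    ∃ t ∈ Icc a b, metricSlope E (γ t) < ⊤ ∧
      (b - a) * (metricSlope E (γ t)).toReal ^ 2 ≤ Φ b - Φ a := by
  have hvol : volume (Ioc a b) = ENNReal.ofReal (b - a) := Real.volume_Ioc
  have hne : ENNReal.ofReal (b - a) ≠ 0 := by simpa using hab
  obtain ⟨t, ht, hle⟩ := exists_le_setLAverage (μ := volume) (s := Ioc a b)
    (f := fun t => metricSlope E (γ t) ^ 2) (hvol ▸ hne) (hvol ▸ ENNReal.ofReal_ne_top) (by
      rw [restrict_Ioc_eq_restrict_Icc]
      exact (aemeasurable_comp_of_lowerSemicontinuous hE hab.le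
        (h.continuousOn.mono (Icc_subset_Icc ha hb))).pow_const 2)
  rw [setLAverage_eq, hvol, ENNReal.le_div_iff_mul_le (.inl hne) (.inl ENNReal.ofReal_ne_top),
    mul_comm] at hle
  replace hle := hle.trans (h.lintegral_le a b ha hab.le hb)
  have hfin : metricSlope E (γ t) ≠ ⊤ := fun htop => by simp [htop, hab] at hle
  refine ⟨t, Ioc_subset_Icc_self ht, hfin.lt_top, ?_⟩
  rwa [← ENNReal.ofReal_toReal hfin, ← ENNReal.ofReal_pow ENNReal.toReal_nonneg,
    ← ENNReal.ofReal_mul (sub_pos.2 hab).le,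
    ENNReal.ofReal_le_ofReal_iff (sub_nonneg.2 (h.monotone hab.le))] at hle

lemma exists_seq_energy_le (h : IsActionPrimitive E γ Φ) (hE : Setting E)
    (hslope : LowerSemicontinuous (metricSlope E)) :
    ∃ t : ℕ → ℝ, (∀ k, t k ∈ Icc 0 1) ∧ Tendsto t atTop (𝓝 0) ∧ (∀ k, E (γ (t k)) < ⊤) ∧
      BddAbove (range fun k => (E (γ (t k))).toReal) := by
  obtain ⟨κ, hflow⟩ := hE.exists_isIntegralFlow
  have hpos : ∀ k : ℕ, (0 : ℝ) < (1 / 2) ^ k := fun k => by positivity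
  have hone : ∀ k : ℕ, (1 / 2 : ℝ) ^ k ≤ 1 := fun k => pow_le_one₀ (by norm_num) (by norm_num)
  choose t ht hfin hS using fun k : ℕ => h.exists_mul_metricSlope_sq_le hslope (hpos (k + 1)).le
    (pow_lt_pow_right_of_lt_one₀ (by norm_num) (by norm_num) k.lt_succ_self) (hone k)
  have ht01 : ∀ k, t k ∈ Icc 0 1 := fun k =>
    ⟨(hpos (k + 1)).le.trans (ht k).1, (ht k).2.trans (hone k)⟩
  have hdom : ∀ k, E (γ (t k)) < ⊤ := fun k => lt_top_of_metricSlope_lt_top (hfin k)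
  refine ⟨t, ht01, squeeze_zero (fun k => (ht01 k).1) (fun k => (ht k).2)
    (tendsto_pow_atTop_nhds_zero_of_lt_one (by norm_num) (by norm_num)), hdom, ?_⟩
  have hκ : 0 ≤ κ := (hflow (γ 0)).choose_spec.1.nonneg
  refine bddAbove_range_of_succ_le (φ := fun k => Φ ((1 / 2) ^ k)) (C := 3 + κ) (by positivity)
    (fun k => h.monotone (hpos k).le) fun k => ?_
  obtain ⟨u, hu, hu0⟩ := hflow (γ (t (k + 1)))
  have htt : t (k + 1) ≤ t k := (ht (k + 1)).2.trans (ht k).1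
  have hΦ : Φ (t k) - Φ (t (k + 1)) ≤ Φ ((1 / 2) ^ k) - Φ ((1 / 2) ^ (k + 2)) :=
    sub_le_sub (h.monotone (ht k).2) (h.monotone (ht (k + 1)).1)
  rw [← hu0]
  refine hu.energy_le_add_mul hE (hu0 ▸ hfin (k + 1)) (hdom k) ⟨hpos k, hone k⟩ ?_ ?_ <;> rw [hu0]
  · calc (1 / 2) ^ k / 4 * (metricSlope E (γ (t (k + 1)))).toReal ^ 2
        = ((1 / 2) ^ (k + 1) - (1 / 2) ^ (k + 1 + 1)) *
            (metricSlope E (γ (t (k + 1)))).toReal ^ 2 := by ring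
      _ ≤ Φ ((1 / 2) ^ (k + 1)) - Φ ((1 / 2) ^ (k + 2)) := hS (k + 1)
      _ ≤ Φ ((1 / 2) ^ k) - Φ ((1 / 2) ^ (k + 2)) :=
        sub_le_sub_right (h.monotone (pow_le_pow_of_le_one (by norm_num) (by norm_num)
          k.le_succ)) _
  · calc dist (γ (t (k + 1))) (γ (t k)) ^ 2
        ≤ (t k - t (k + 1)) * (Φ (t k) - Φ (t (k + 1))) :=
          h.dist_sq_le _ _ (ht01 _).1 htt (ht01 _).2
      _ ≤ (1 / 2) ^ k * (Φ ((1 / 2) ^ k) - Φ ((1 / 2) ^ (k + 2))) :=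
        mul_le_mul (by linarith [(ht k).2, (ht01 (k + 1)).1]) hΦ
          (sub_nonneg.2 (h.monotone htt)) (hpos k).le

lemma energy_lt_top (h : IsActionPrimitive E γ Φ) (hE : Setting E)
    (hslope : LowerSemicontinuous (metricSlope E)) : E (γ 0) < ⊤ := by
  obtain ⟨t, ht, htend, hdom, B, hB⟩ := h.exists_seq_energy_le hE hslope
  have hγ : Tendsto (fun k => γ (t k)) atTop (𝓝 (γ 0)) :=
    (h.continuousOn 0 (by simp)).tendsto.comp
      (tendsto_nhdsWithin_iff.2 ⟨htend, .of_forall ht⟩)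
  refine lt_of_le_of_lt (le_of_forall_lt fun c hc => ?_) (EReal.coe_lt_top B)
  obtain ⟨k, hk⟩ := (hγ.eventually (hE.lsc (γ 0) c hc)).exists
  refine hk.trans_le ?_
  rw [← hE.coe_toReal (hdom k)]
  exact EReal.coe_le_coe (hB (mem_range_self k))

end IsActionPrimitive

lemma energy_lt_top_of_schrodingerAction_lt_top (hE : Setting E)
    (hslope : LowerSemicontinuous (metricSlope E)) {ε : ℝ} (hε : ε ≠ 0)
    (h : schrodingerAction E ε γ < ⊤) : E (γ 0) < ⊤ ∧ E (γ 1) < ⊤ := by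
  obtain ⟨Φ, hΦ⟩ := exists_isActionPrimitive hε h
  exact ⟨hΦ.energy_lt_top hE hslope, by simpa using hΦ.reverse.energy_lt_top hE hslope⟩

end FiniteEnergyEndpoints

end MetricSchrodinger

end

theorem proposition4p2_general {X : Type*} [MetricSpace X] (E : X → EReal)
    (hE : MetricSchrodinger.Setting E) (hσ : MetricSchrodinger.WeakTopologyAssumption E)
    (x y : X) (ε : ℝ) (hε : ε ≠ 0) :
    MetricSchrodinger.SchrodingerSolvable E ε x y ↔
      E x < ⊤ ∧ E y < ⊤ ∧ ∃ γ : ℝ → X, MetricSchrodinger.ACOn γ 0 1 ∧ γ 0 = x ∧ γ 1 = y := by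
  constructor
  · rintro ⟨γ, ⟨-, rfl, rfl⟩, hfin, -⟩
    obtain ⟨N, hN, hslope⟩ := hσ.exists_isWeakNhds
    obtain ⟨h0, h1⟩ := MetricSchrodinger.energy_lt_top_of_schrodingerAction_lt_top hE
      (hN.lowerSemicontinuous hslope) hε hfin
    have hkin := (ENNReal.add_lt_top.1 hfin).1
    exact ⟨h0, h1, γ, MetricSchrodinger.acOn_of_kineticEnergy_lt_top hkin, rfl, rfl⟩
  · rintro ⟨hx, hy, γ, hγ, rfl, rfl⟩
    have hjoined := MetricSchrodinger.finiteActionJoined_of_acOn hE hγ hx hy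
    exact MetricSchrodinger.schrodingerSolvable_of_action_lt_top hσ
      (hjoined.exists_schrodingerAction_lt_top ε)

theorem proposition4p2 {X : Type*} [MetricSpace X] [CompleteSpace X]
    [TopologicalSpace.SeparableSpace X] (E : X → EReal)
    (hE : MetricSchrodinger.Setting E) (hσ : MetricSchrodinger.WeakTopologyAssumption E)
    (x y : X) (ε : ℝ) (hε : 0 < ε) :
    MetricSchrodinger.SchrodingerSolvable E ε x y ↔
      E x < ⊤ ∧ E y < ⊤ ∧ ∃ γ : ℝ → X, MetricSchrodinger.ACOn γ 0 1 ∧ γ 0 = x ∧ γ 1 = y :=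
  proposition4p2_general E hE hσ x y ε hε.ne'
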